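/- Let $\alpha>0$, let $\mathbb{R}^+=(0,\infty)$ and $\mathbb{C}^+=\{z\in\mathbb{C}:\Re z>0\}$. Let $H_2(\mathbb{C}^+)$ be the Hardy space of holomorphic functions $F$ on $\mathbb{C}^+$ with norm $$\|F\|_2=\sup_{x>0}\Big(\frac1{2\pi}\int_{-\infty}^{\infty}|F(x+iy)|^2\,dy\Big)^{1/2}<\infty ,$$ and put $T_2(t)F(z)=e^{-t/2}F(e^{-t}z)$ for $t\in\mathbb{R}$. Consider the Cesàro–Hardy operators $$\mathcal{C}^*_\alpha f(s)=\alpha\int_s^\infty\frac{(u-s)^{\alpha-1}}{u^\alpha}f(u)\,du\quad (f\in L_2(\mathbb{R}^+),\ \text{a.e. } s>0),$$ $$\mathfrak{C}^*_\alpha F=\alpha\int_0^\infty(1-e^{-t})^{\alpha-1}e^{-t/2}\,T_2(-t)F\,dt\quad (F\in H_2(\mathbb{C}^+)),$$ the second being a Bochner integral in $H_2(\mathbb{C}^+)$. These are everywhere defined injective operators $L_2(\mathbb{R}^+)\to L_2(\mathbb{R}^+)$ and $H_2(\mathbb{C}^+)\to H_2(\mathbb{C}^+)$. Define their range spaces $$\mathcal{T}_2^{(\alpha)}(t^\alpha)=\mathcal{C}^*_\alpha(L_2(\mathbb{R}^+)),\qquad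 \|f\|_{2,(\alpha)}=\Gamma(\alpha+1)\,\|(\mathcal{C}^*_\alpha)^{-1}f\|_2,$$ $$H_2^{(\alpha)}(\mathbb{C}^+)=\mathfrak{C}^*_\alpha(H_2(\mathbb{C}^+)),\qquad \|F\|_{2,(\alpha)}=\Gamma(\alpha+1)\,\|(\mathfrak{C}^*_\alpha)^{-1}F\|_2 .$$ Then: (i) $H_2^{(\alpha)}(\mathbb{C}^+)$ is a reproducing kernel Hilbert space of functions on $\mathbb{C}^+$, with reproducing kernel $$K_\alpha(z,w)=\int_0^1\int_0^1\frac{(1-x)^{\alpha-1}}{\Gamma(\alpha)}\,\frac{(1-y)^{\alpha-1}}{\Gamma(\alpha)}\,\frac{1}{xz+y\overline w}\,dx\,dy,\qquad z,w\in\mathbb{C}^+,$$ where the integral is absolutely convergent. (ii) The Laplace transform $\mathcal{L}f(z)=\int_0^\infty f(t)e^{-zt}\,dt$ is a linear isometric isomorphism from $\mathcal{T}_2^{(\alpha)}(t^\alpha)$ onto $H_2^{(\alpha)}(\mathbb{C}^+)$. -/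

import Mathlib

open MeasureTheory Set
open scoped ENNReal ComplexConjugate

noncomputable section

/-! ### The right half-plane and the Hardy space `H₂(ℂ⁺)` -/

/-- The open right half-plane `ℂ⁺ = {z : Re z > 0}`. -/
abbrev CPlus : Type := {z : ℂ // 0 < z.re}

/-- Extension by zero of a function on `ℂ⁺` to the whole plane. -/
def zeroExt (F : CPlus → ℂ) (z : ℂ) : ℂ := if h : 0 < z.re then F ⟨z, h⟩ else 0

/-- The quantity `(1/(2π) ∫ |F(x+iy)|² dy)^{1/2}`, written as the `L₂`-norm of `y ↦ F(x+iy)` for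
the measure `dy/(2π)`. -/
def lineNorm (F : CPlus → ℂ) (x : ℝ) : ℝ≥0∞ :=
  eLpNorm (fun y : ℝ => zeroExt F (x + y * Complex.I)) 2
    (ENNReal.ofReal (1 / (2 * Real.pi)) • volume)

/-- `sup_{x>0} (1/(2π) ∫ |F(x+iy)|² dy)^{1/2}`, possibly infinite. -/
def hardyENorm (F : CPlus → ℂ) : ℝ≥0∞ := ⨆ x ∈ Ioi (0 : ℝ), lineNorm F x

/-- `F` is holomorphic on `ℂ⁺`. -/
def IsHolo (F : CPlus → ℂ) : Prop := DifferentiableOn ℂ (zeroExt F) {z | 0 < z.re}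

theorem zeroExt_apply (F : CPlus → ℂ) {z : ℂ} (h : 0 < z.re) : zeroExt F z = F ⟨z, h⟩ := by
  simp [zeroExt, h]

theorem zeroExt_add (F G : CPlus → ℂ) : zeroExt (F + G) = zeroExt F + zeroExt G := by
  ext z
  by_cases h : 0 < z.re <;> simp [zeroExt, h]

theorem zeroExt_smul (c : ℂ) (F : CPlus → ℂ) : zeroExt (c • F) = c • zeroExt F := by
  ext z
  by_cases h : 0 < z.re <;> simp [zeroExt, h]

theorem zeroExt_zero : zeroExt 0 = 0 := by
  ext z
  by_cases h : 0 < z.re <;> simp [zeroExt]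

theorem IsHolo.continuous_line {F : CPlus → ℂ} (hF : IsHolo F) {x : ℝ} (hx : 0 < x) :
    Continuous (fun y : ℝ => zeroExt F (x + y * Complex.I)) := by
  apply hF.continuousOn.comp_continuous (by fun_prop)
  intro y
  simpa using hx

theorem lineNorm_add_le {F G : CPlus → ℂ} (hF : IsHolo F) (hG : IsHolo G) {x : ℝ} (hx : 0 < x) :
    lineNorm (F + G) x ≤ lineNorm F x + lineNorm G x := by
  have h := eLpNorm_add_le (μ := ENNReal.ofReal (1 / (2 * Real.pi)) • volume) (p := 2)
    (hF.continuous_line hx).aestronglyMeasurable (hG.continuous_line hx).aestronglyMeasurable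
    (by norm_num)
  rw [lineNorm, zeroExt_add]
  exact h

theorem lineNorm_smul (c : ℂ) (F : CPlus → ℂ) (x : ℝ) :
    lineNorm (c • F) x = ‖c‖ₑ * lineNorm F x := by
  simp only [lineNorm, zeroExt_smul]
  exact eLpNorm_const_smul c _ _ _

theorem lineNorm_le (F : CPlus → ℂ) {x : ℝ} (hx : 0 < x) : lineNorm F x ≤ hardyENorm F :=
  le_iSup₂ (f := fun (x : ℝ) (_ : x ∈ Ioi (0 : ℝ)) => lineNorm F x) x hx

theorem hardyENorm_add_le {F G : CPlus → ℂ} (hF : IsHolo F) (hG : IsHolo G) :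
    hardyENorm (F + G) ≤ hardyENorm F + hardyENorm G :=
  iSup₂_le fun _ hx => (lineNorm_add_le hF hG hx).trans
    (add_le_add (lineNorm_le F hx) (lineNorm_le G hx))

theorem hardyENorm_smul (c : ℂ) (F : CPlus → ℂ) :
    hardyENorm (c • F) = ‖c‖ₑ * hardyENorm F := by
  simp only [hardyENorm, lineNorm_smul, ENNReal.mul_iSup]

theorem hardyENorm_zero : hardyENorm 0 = 0 := by
  simp [hardyENorm, lineNorm, zeroExt_zero]

/-- The linear space of holomorphic functions on `ℂ⁺` with finite Hardy norm. -/
def hardyTwoSubmodule : Submodule ℂ (CPlus → ℂ) where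
  carrier := {F | IsHolo F ∧ hardyENorm F < ∞}
  add_mem' := by
    rintro F G ⟨hF, hF'⟩ ⟨hG, hG'⟩
    refine ⟨?_, (hardyENorm_add_le hF hG).trans_lt (ENNReal.add_lt_top.2 ⟨hF', hG'⟩)⟩
    rw [IsHolo, zeroExt_add]
    exact DifferentiableOn.add hF hG
  zero_mem' := by
    refine ⟨?_, by simp [hardyENorm_zero]⟩
    rw [IsHolo, zeroExt_zero]
    exact differentiableOn_const 0
  smul_mem' := by
    rintro c F ⟨hF, hF'⟩
    refine ⟨?_, ?_⟩
    · rw [IsHolo, zeroExt_smul]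
      exact DifferentiableOn.const_smul hF c
    · rw [hardyENorm_smul]
      exact ENNReal.mul_lt_top (by simp) hF'

/-- The Hardy space `H₂(ℂ⁺)`, with the norm `sup_{x>0} (1/(2π) ∫ |F(x+iy)|² dy)^{1/2}`. -/
def HardyTwo : Type := hardyTwoSubmodule

instance : AddCommGroup HardyTwo := inferInstanceAs (AddCommGroup hardyTwoSubmodule)

instance : Module ℂ HardyTwo := inferInstanceAs (Module ℂ hardyTwoSubmodule)

instance : CoeFun HardyTwo (fun _ => CPlus → ℂ) := ⟨fun F => F.1⟩

theorem HardyTwo.coe_add (F G : HardyTwo) : (⇑(F + G) : CPlus → ℂ) = ⇑F + ⇑G := rfl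

theorem HardyTwo.coe_smul (c : ℂ) (F : HardyTwo) : (⇑(c • F) : CPlus → ℂ) = c • ⇑F := rfl

theorem HardyTwo.ext {F G : HardyTwo} (h : ∀ z, F z = G z) : F = G := Subtype.ext (funext h)

instance : Norm HardyTwo := ⟨fun F => (hardyENorm F).toReal⟩

theorem HardyTwo.norm_def (F : HardyTwo) : ‖F‖ = (hardyENorm F).toReal := rfl

theorem HardyTwo.eq_zero_of_hardyENorm {F : HardyTwo} (h : hardyENorm F = 0) : F = 0 := by
  apply HardyTwo.ext
  rintro ⟨z, hz⟩
  have h1 : lineNorm F z.re = 0 := le_antisymm ((lineNorm_le F hz).trans h.le) zero_le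
  have hc := F.2.1.continuous_line hz
  rw [lineNorm, eLpNorm_eq_zero_iff hc.aestronglyMeasurable (by norm_num),
    Measure.ae_ennreal_smul_measure_eq (by simp [Real.pi_pos])] at h1
  have h2 := (hc.ae_eq_iff_eq volume continuous_const).1 h1
  have h3 := congrFun h2 z.im
  simp only [Complex.re_add_im] at h3
  rw [zeroExt_apply _ hz] at h3
  exact h3

theorem HardyTwo.normedSpaceCore : NormedSpace.Core ℂ HardyTwo where
  norm_nonneg _ := ENNReal.toReal_nonneg
  norm_smul c F := by
    simp only [HardyTwo.norm_def, HardyTwo.coe_smul, hardyENorm_smul, ENNReal.toReal_mul,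
      toReal_enorm]
  norm_triangle F G := by
    simp only [HardyTwo.norm_def, HardyTwo.coe_add]
    rw [← ENNReal.toReal_add F.2.2.ne G.2.2.ne]
    exact ENNReal.toReal_mono (ENNReal.add_ne_top.2 ⟨F.2.2.ne, G.2.2.ne⟩)
      (hardyENorm_add_le F.2.1 G.2.1)
  norm_eq_zero_iff F := by
    constructor
    · intro h
      rw [HardyTwo.norm_def, ENNReal.toReal_eq_zero_iff] at h
      exact HardyTwo.eq_zero_of_hardyENorm (h.resolve_right F.2.2.ne)
    · rintro rfl
      have h0 : hardyENorm (⇑(0 : HardyTwo)) = 0 := hardyENorm_zero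
      rw [HardyTwo.norm_def, h0, ENNReal.toReal_zero]

instance : NormedAddCommGroup HardyTwo := NormedAddCommGroup.ofCore HardyTwo.normedSpaceCore

instance : NormedSpace ℂ HardyTwo := NormedSpace.ofCore HardyTwo.normedSpaceCore

/-! ### The dilation group and the complex Cesàro-Hardy operator -/

/-- The point `e^{-t} z` of `ℂ⁺`. -/
def dilatePoint (t : ℝ) (z : CPlus) : CPlus :=
  ⟨(Real.exp (-t) : ℂ) * z, by
    rw [Complex.re_ofReal_mul]
    exact mul_pos (Real.exp_pos _) z.2⟩

/-- `z ↦ e^{-t/2} F(e^{-t} z)`. -/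
def dilateFun (t : ℝ) (F : CPlus → ℂ) (z : CPlus) : ℂ :=
  (Real.exp (-t / 2) : ℂ) * F (dilatePoint t z)

theorem zeroExt_dilateFun (t : ℝ) (F : CPlus → ℂ) (z : ℂ) :
    zeroExt (dilateFun t F) z = (Real.exp (-t / 2) : ℂ) * zeroExt F ((Real.exp (-t) : ℂ) * z) := by
  have hre : ((Real.exp (-t) : ℂ) * z).re = Real.exp (-t) * z.re := Complex.re_ofReal_mul _ _
  by_cases h : 0 < z.re
  · have h' : 0 < ((Real.exp (-t) : ℂ) * z).re := hre ▸ mul_pos (Real.exp_pos _) h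
    rw [zeroExt_apply _ h, zeroExt_apply _ h']
    rfl
  · have h' : ¬ 0 < ((Real.exp (-t) : ℂ) * z).re := by
      rw [hre]
      exact fun hh => h (pos_of_mul_pos_right hh (Real.exp_pos _).le)
    rw [zeroExt, zeroExt, dif_neg h, dif_neg h', mul_zero]

theorem isHolo_dilateFun (t : ℝ) {F : CPlus → ℂ} (hF : IsHolo F) : IsHolo (dilateFun t F) := by
  have h : zeroExt (dilateFun t F) =
      fun z => (Real.exp (-t / 2) : ℂ) * zeroExt F ((Real.exp (-t) : ℂ) * z) :=
    funext (zeroExt_dilateFun t F)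
  rw [IsHolo, h]
  refine DifferentiableOn.const_mul (DifferentiableOn.comp hF ?_ ?_) _
  · exact (differentiable_id.const_mul _).differentiableOn
  · intro z hz
    change 0 < ((Real.exp (-t) : ℂ) * z).re
    rw [Complex.re_ofReal_mul]
    exact mul_pos (Real.exp_pos _) hz

theorem lineNorm_dilateFun (t : ℝ) (F : CPlus → ℂ) (x : ℝ) :
    lineNorm (dilateFun t F) x = ‖(Real.exp (-t / 2) : ℂ)‖ₑ *
      (ENNReal.ofReal |(Real.exp (-t))⁻¹| ^ (1 / (2 : ℝ≥0∞)).toReal *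
        lineNorm F (Real.exp (-t) * x)) := by
  have ha : Real.exp (-t) ≠ 0 := (Real.exp_pos _).ne'
  have he : MeasurableEmbedding (fun y : ℝ => Real.exp (-t) * y) :=
    (Homeomorph.mulLeft₀ _ ha).measurableEmbedding
  have h1 : (fun y : ℝ => zeroExt (dilateFun t F) (x + y * Complex.I)) =
      (Real.exp (-t / 2) : ℂ) • ((fun y : ℝ => zeroExt F
        ((Real.exp (-t) * x : ℝ) + y * Complex.I)) ∘ fun y : ℝ => Real.exp (-t) * y) := by
    ext y
    simp only [zeroExt_dilateFun, Pi.smul_apply, Function.comp, smul_eq_mul]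
    congr 2
    push_cast
    ring
  rw [lineNorm, h1, eLpNorm_const_smul, ← he.eLpNorm_map_measure, Measure.map_smul,
    Real.map_volume_mul_left ha, smul_comm, eLpNorm_smul_measure_of_ne_zero]
  · rfl
  · simp [Real.exp_pos]

theorem hardyENorm_dilateFun_lt_top (t : ℝ) {F : CPlus → ℂ} (hF : hardyENorm F < ∞) :
    hardyENorm (dilateFun t F) < ∞ := by
  refine lt_of_le_of_lt (b := ‖(Real.exp (-t / 2) : ℂ)‖ₑ *
      (ENNReal.ofReal |(Real.exp (-t))⁻¹| ^ (1 / (2 : ℝ≥0∞)).toReal * hardyENorm F)) ?_ ?_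
  · refine iSup₂_le fun x hx => ?_
    rw [lineNorm_dilateFun]
    gcongr
    exact lineNorm_le F (mul_pos (Real.exp_pos _) hx)
  · refine ENNReal.mul_lt_top (by simp) (ENNReal.mul_lt_top ?_ hF)
    exact ENNReal.rpow_lt_top_of_nonneg ENNReal.toReal_nonneg ENNReal.ofReal_ne_top

/-- The group `T₂(t)F(z) = e^{-t/2} F(e^{-t}z)`, `t ∈ ℝ`, acting on `H₂(ℂ⁺)`. -/
def hardyDilation (t : ℝ) : HardyTwo →ₗ[ℂ] HardyTwo where
  toFun F := ⟨dilateFun t F, isHolo_dilateFun t F.2.1, hardyENorm_dilateFun_lt_top t F.2.2⟩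
  map_add' _ _ := HardyTwo.ext fun _ => mul_add _ _ _
  map_smul' _ _ := HardyTwo.ext fun _ => mul_left_comm _ _ _

/-- `φ_{α,2}(t) = α (1 - e^{-t})^{α-1} e^{-t/2}`. -/
def subordinator (α t : ℝ) : ℝ := α * (1 - Real.exp (-t)) ^ (α - 1) * Real.exp (-t / 2)

/-- The complex Cesàro-Hardy operator `𝔠*_α F = ∫₀^∞ φ_{α,2}(t) T₂(-t)F dt`, a Bochner integral in
`H₂(ℂ⁺)`, on the domain of all `F` for which this integral converges. -/
def hardyCesaroStar (α : ℝ) : HardyTwo →ₗ.[ℂ] HardyTwo where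
  domain :=
    { carrier := {F | IntegrableOn (fun t : ℝ => (subordinator α t : ℂ) • hardyDilation (-t) F)
        (Ioi 0)}
      add_mem' := by
        intro F G hF hG
        simp only [mem_ofPred_eq, map_add, smul_add]
        exact Integrable.add hF hG
      zero_mem' := by
        simp only [mem_ofPred_eq, map_zero, smul_zero]
        exact integrableOn_zero
      smul_mem' := by
        intro c F hF
        simp only [mem_ofPred_eq, map_smul] at hF ⊢
        simp only [smul_comm _ c]
        exact Integrable.smul c hF }
  toFun :=
    { toFun := fun F => ∫ t in Ioi (0 : ℝ), (subordinator α t : ℂ) • hardyDilation (-t) F.1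
      map_add' := by
        intro F G
        simp only [Submodule.coe_add, map_add, smul_add]
        exact integral_add F.2 G.2
      map_smul' := by
        intro c F
        simp only [Submodule.coe_smul, map_smul, smul_comm _ c, RingHom.id_apply]
        exact integral_smul c _ }

/-- The Hardy-Sobolev space `H₂^{(α)}(ℂ⁺)`: the range of `𝔠*_α` on `H₂(ℂ⁺)`. -/
def HardySobolev (α : ℝ) : Submodule ℂ HardyTwo := (hardyCesaroStar α).inverse.domain

/-- `‖F‖_{2,(α)} = Γ(α+1) ‖(𝔠*_α)⁻¹ F‖₂` for `F ∈ H₂^{(α)}(ℂ⁺)`. -/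
def hardySobolevNorm (α : ℝ) (F : HardySobolev α) : ℝ :=
  Real.Gamma (α + 1) * ‖(hardyCesaroStar α).inverse F‖

/-! ### The real Cesàro-Hardy operator and the Lebesgue-Sobolev space -/

/-- The space `L₂(ℝ⁺)` of complex functions. -/
abbrev LTwoPos : Type := Lp ℂ 2 (volume.restrict (Ioi (0 : ℝ)))

/-- The integrand `u ↦ (u-s)^{α-1} u^{-α} f(u)`. -/
def cesaroIntegrand (α : ℝ) (f : ℝ → ℂ) (s u : ℝ) : ℂ :=
  (((u - s) ^ (α - 1) / u ^ α : ℝ) : ℂ) * f u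

/-- `s ↦ α ∫_s^∞ (u-s)^{α-1} u^{-α} f(u) du`. -/
def cesaroFun (α : ℝ) (f : ℝ → ℂ) (s : ℝ) : ℂ := (α : ℂ) * ∫ u in Ioi s, cesaroIntegrand α f s u

/-- The integral defining `cesaroFun α f s` converges for almost every `s > 0`, and `cesaroFun α f`
belongs to `L₂(ℝ⁺)`. -/
def CesaroConverges (α : ℝ) (f : ℝ → ℂ) : Prop :=
  (∀ᵐ s ∂volume.restrict (Ioi (0 : ℝ)), IntegrableOn (cesaroIntegrand α f s) (Ioi s)) ∧
    MemLp (cesaroFun α f) 2 (volume.restrict (Ioi (0 : ℝ)))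

theorem ae_restrict_Ioi_of_pos {s : ℝ} (hs : 0 < s) {p : ℝ → Prop}
    (h : ∀ᵐ u ∂volume.restrict (Ioi (0 : ℝ)), p u) : ∀ᵐ u ∂volume.restrict (Ioi s), p u :=
  ae_mono (Measure.restrict_mono (Ioi_subset_Ioi hs.le) le_rfl) h

theorem cesaroIntegrand_add (α : ℝ) (f g : LTwoPos) {s : ℝ} (hs : 0 < s) :
    cesaroIntegrand α (f + g : LTwoPos) s =ᵐ[volume.restrict (Ioi s)]
      cesaroIntegrand α f s + cesaroIntegrand α g s := by
  filter_upwards [ae_restrict_Ioi_of_pos hs (Lp.coeFn_add f g)] with u hu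
  simp only [cesaroIntegrand, hu, Pi.add_apply, mul_add]

theorem cesaroIntegrand_smul (α : ℝ) (c : ℂ) (f : LTwoPos) {s : ℝ} (hs : 0 < s) :
    cesaroIntegrand α (c • f : LTwoPos) s =ᵐ[volume.restrict (Ioi s)]
      c • cesaroIntegrand α f s := by
  filter_upwards [ae_restrict_Ioi_of_pos hs (Lp.coeFn_smul c f)] with u hu
  simp only [cesaroIntegrand, hu, Pi.smul_apply, smul_eq_mul]
  ring

theorem cesaroFun_add {α : ℝ} {f g : LTwoPos} (hf : CesaroConverges α f)
    (hg : CesaroConverges α g) :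
    cesaroFun α (f + g : LTwoPos) =ᵐ[volume.restrict (Ioi (0 : ℝ))]
      cesaroFun α f + cesaroFun α g := by
  filter_upwards [hf.1, hg.1, ae_restrict_mem measurableSet_Ioi] with s hfs hgs hs
  simp only [cesaroFun, Pi.add_apply]
  rw [integral_congr_ae (cesaroIntegrand_add α f g hs), ← mul_add]
  congr 1
  exact integral_add hfs hgs

theorem cesaroFun_smul (α : ℝ) (c : ℂ) (f : LTwoPos) :
    cesaroFun α (c • f : LTwoPos) =ᵐ[volume.restrict (Ioi (0 : ℝ))] c • cesaroFun α f := by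
  filter_upwards [ae_restrict_mem measurableSet_Ioi] with s hs
  simp only [cesaroFun, Pi.smul_apply, smul_eq_mul]
  rw [integral_congr_ae (cesaroIntegrand_smul α c f hs), mul_left_comm]
  congr 1
  exact integral_smul c _

theorem CesaroConverges.add {α : ℝ} {f g : LTwoPos} (hf : CesaroConverges α f)
    (hg : CesaroConverges α g) : CesaroConverges α (f + g : LTwoPos) := by
  refine ⟨?_, (hf.2.add hg.2).ae_eq (cesaroFun_add hf hg).symm⟩
  filter_upwards [hf.1, hg.1, ae_restrict_mem measurableSet_Ioi] with s hfs hgs hs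
  exact (Integrable.add hfs hgs).congr (cesaroIntegrand_add α f g hs).symm

theorem CesaroConverges.smul {α : ℝ} (c : ℂ) {f : LTwoPos} (hf : CesaroConverges α f) :
    CesaroConverges α (c • f : LTwoPos) := by
  refine ⟨?_, (hf.2.const_smul c).ae_eq (cesaroFun_smul α c f).symm⟩
  filter_upwards [hf.1, ae_restrict_mem measurableSet_Ioi] with s hfs hs
  exact (Integrable.smul c hfs).congr (cesaroIntegrand_smul α c f hs).symm

theorem CesaroConverges.zero (α : ℝ) : CesaroConverges α (0 : LTwoPos) := by
  have h0 : ∀ s : ℝ, 0 < s →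
      cesaroIntegrand α (0 : LTwoPos) s =ᵐ[volume.restrict (Ioi s)] (0 : ℝ → ℂ) := by
    intro s hs
    filter_upwards [ae_restrict_Ioi_of_pos hs (Lp.coeFn_zero ℂ 2 (volume.restrict (Ioi (0 : ℝ))))]
      with u hu
    simp only [cesaroIntegrand, hu, Pi.zero_apply, mul_zero]
  constructor
  · filter_upwards [ae_restrict_mem measurableSet_Ioi] with s hs
    exact (integrable_zero _ _ _).congr (h0 s hs).symm
  · refine (MemLp.zero (ε := ℂ)).ae_eq ?_
    filter_upwards [ae_restrict_mem measurableSet_Ioi] with s hs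
    rw [cesaroFun, integral_congr_ae (h0 s hs)]
    simp

/-- The real Cesàro-Hardy operator `C*_α f(s) = α ∫_s^∞ (u-s)^{α-1} u^{-α} f(u) du` in `L₂(ℝ⁺)`, on
the domain of all `f` for which the integral converges for almost every `s > 0` and gives an element
of `L₂(ℝ⁺)`. -/
def cesaroStar (α : ℝ) : LTwoPos →ₗ.[ℂ] LTwoPos where
  domain :=
    { carrier := {f | CesaroConverges α f}
      add_mem' := fun hf hg => hf.add hg
      zero_mem' := CesaroConverges.zero α
      smul_mem' := fun c _ hf => hf.smul c }
  toFun :=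
    { toFun := fun f => MemLp.toLp (cesaroFun α f.1) f.2.2
      map_add' := fun f g => by
        rw [← MemLp.toLp_add, MemLp.toLp_eq_toLp_iff]
        exact cesaroFun_add f.2 g.2
      map_smul' := fun c f => by
        rw [RingHom.id_apply, ← MemLp.toLp_const_smul, MemLp.toLp_eq_toLp_iff]
        exact cesaroFun_smul α c f.1 }

/-- The Lebesgue-Sobolev space `𝒯₂^{(α)}(t^α)`: the range of `C*_α` on `L₂(ℝ⁺)`. -/
def LebesgueSobolev (α : ℝ) : Submodule ℂ LTwoPos := (cesaroStar α).inverse.domain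

/-- `‖f‖_{2,(α)} = Γ(α+1) ‖(C*_α)⁻¹ f‖₂` for `f ∈ 𝒯₂^{(α)}(t^α)`. -/
def lebesgueSobolevNorm (α : ℝ) (f : LebesgueSobolev α) : ℝ :=
  Real.Gamma (α + 1) * ‖(cesaroStar α).inverse f‖

/-! ### Laplace transform and reproducing kernels -/

/-- `ℒf(z) = ∫₀^∞ f(t) e^{-zt} dt`. -/
def laplace (f : ℝ → ℂ) (z : ℂ) : ℂ := ∫ t in Ioi (0 : ℝ), f t * Complex.exp (-z * t)

/-- `(1-x)^{α-1}/Γ(α) · (1-y)^{α-1}/Γ(α) · 1/(xz + y w̄)`. -/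
def kernelIntegrand (α : ℝ) (z w : CPlus) (x y : ℝ) : ℂ :=
  (((1 - x) ^ (α - 1) / Real.Gamma α * ((1 - y) ^ (α - 1) / Real.Gamma α) : ℝ) : ℂ) *
    (1 / (x * (z : ℂ) + y * conj (w : ℂ)))

/-- The linear space `V` of functions on `X` (through the map `ev`), with the norm `N`, is a
reproducing kernel Hilbert space with reproducing kernel `K`: as a space of functions with a norm it
is the same as a (complete) `RKHS` whose kernel is `K`. -/
def IsRKHSWithKernel {V X : Type} [AddCommGroup V] [Module ℂ V] (ev : V → X → ℂ) (N : V → ℝ)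
    (K : X → X → ℂ) : Prop :=
  ∃ (H : Type) (_ : NormedAddCommGroup H) (_ : InnerProductSpace ℂ H) (_ : CompleteSpace H)
    (_ : RKHS ℂ H X ℂ) (e : V ≃ₗ[ℂ] H),
    (∀ F x, e F x = ev F x) ∧ (∀ F, ‖e F‖ = N F) ∧ ∀ z w, RKHS.kernel H z w 1 = K z w

end

/-! Both operators are averages of one unitary group and its inverse. By Plancherel on vertical
lines and the Paley-Wiener theorem, the Laplace transform is unitary from `L₂(ℝ⁺)` onto `H₂(ℂ⁺)`
(`laplaceEquiv`). It carries `U(t)f(s) = e^{t/2} f(e^t s)` to `T₂(t)`. With `φ = subordinator α`,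
the substitution `u = e^t s` turns the real Cesàro integral into `A = ∫ φ(t) U(t) dt` (`cesaroOp`,
`cesaroFun_ae_eq`). The complex operator is the Laplace conjugate of `B = ∫ φ(t) U(-t) dt`
(`cesaroAdj`, `hardyCesaroStar_apply`).

Since `U(t)* = U(-t)` and the group is commutative, `B = A*` and `AB = BA`: `A` is normal. Thus
`‖Af‖ = ‖Bf‖`, and once `B` is injective there is a unitary `W` with `AW = B`
(`exists_unitary_of_commute_adjoint`). Hence `A` and `B` have the same range with the same
transported norm, which is (ii). Injectivity of `B` holds because the range of `A` contains every
`e^{-xs}` with `x > 0`: a vector killed by `B` has a Laplace transform vanishing on the positive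
axis, so it is zero by the identity theorem.

For (i), put `e_z(t) = e^{-z̄t}`, so that evaluation at `z` of `ℒBf` is `⟨e_z, Bf⟩ = ⟨Ae_z, f⟩`. Up
to the factor `Γ(α+1)⁻²` the kernel is `⟨Ae_z, Ae_w⟩`, which by normality equals `⟨Be_z, Be_w⟩`. As
`U(-t)e_w` is a multiple of `e_{e^{-t}w}` and `⟨e_z, e_w⟩ = 1/(z + w̄)`, the substitutions `x =
e^{-t}`, `y = e^{-r}` give the double integral (`inner_cesaroAdj_expVec`). -/

noncomputable section

open Filter Topology SchwartzMap
open scoped FourierTransform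

/-! ### Plancherel's theorem in the normalisation `dy/(2π)` -/

/-- The `L²` Fourier transform of an integrable function is given by the Fourier integral. -/
theorem coeFn_fourier_toLp {f : ℝ → ℂ} (h1 : Integrable f) (h2 : MemLp f 2) :
    (𝓕 (h2.toLp f) : Lp ℂ 2 (volume : Measure ℝ)) =ᵐ[volume] 𝓕 f := by
  apply ae_eq_of_integral_contDiff_smul_eq
  · exact (Lp.memLp _).locallyIntegrable (by norm_num)
  · exact (VectorFourier.fourierIntegral_continuous Real.continuous_fourierChar
      (by fun_prop) h1).locallyIntegrable
  -- A smooth compactly supported test function is a Schwartz function, on which the `L²` transform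
  -- acts by duality. Moving `𝓕` across the pairing is also legitimate for the integrable `f`, so
  -- the two transforms agree as distributions.
  · intro g hg hgc
    have hgc' : HasCompactSupport (Complex.ofRealCLM ∘ g) := hgc.comp_left rfl
    let G : 𝓢(ℝ, ℂ) := hgc'.toSchwartzMap (Complex.ofRealCLM.contDiff.comp hg)
    have hG : ∀ x, G x = (g x : ℂ) := fun x => rfl
    have e1 := congrArg (fun T => T G) (Lp.fourier_toTemperedDistribution_eq (h2.toLp f))
    simp only [TemperedDistribution.fourier_apply, Lp.toTemperedDistribution_apply] at e1
    have e2 : ∫ x, 𝓕 G x • f x = ∫ x, G x • 𝓕 f x := by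
      rw [SchwartzMap.fourier_coe]
      have h := VectorFourier.integral_fourierIntegral_smul_eq_flip (μ := volume) (ν := volume)
        (L := innerₗ ℝ) Real.continuous_fourierChar (by fun_prop) (G.integrable (μ := volume)) h1
      rw [flip_innerₗ] at h
      exact h
    have e3 : ∫ x, 𝓕 G x • (h2.toLp f) x = ∫ x, 𝓕 G x • f x := by
      apply integral_congr_ae
      filter_upwards [h2.coeFn_toLp] with x hx
      rw [hx]
    rw [e3, e2] at e1
    simpa [hG] using e1.symm

theorem eLpNorm_fourier_eq {f : ℝ → ℂ} (h1 : Integrable f) (h2 : MemLp f 2) :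
    eLpNorm (𝓕 f) 2 volume = eLpNorm f 2 volume := by
  have h := Lp.norm_fourier_eq (h2.toLp f)
  rw [Lp.norm_def, Lp.norm_def, ENNReal.toReal_eq_toReal_iff' (Lp.eLpNorm_ne_top _)
    (Lp.eLpNorm_ne_top _), eLpNorm_congr_ae (coeFn_fourier_toLp h1 h2),
    eLpNorm_congr_ae h2.coeFn_toLp] at h
  exact h

/-- Rescaling `ℝ` by `2π` turns `dy/(2π)` into Lebesgue measure. -/
theorem measurePreserving_div_two_pi :
    MeasurePreserving (fun y : ℝ => y * (2 * Real.pi)⁻¹)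
      (ENNReal.ofReal (1 / (2 * Real.pi)) • volume) volume := by
  refine ⟨by fun_prop, ?_⟩
  have hp : (2 * Real.pi)⁻¹ ≠ 0 := by positivity
  rw [Measure.map_smul, Real.map_volume_mul_right hp, smul_smul, inv_inv,
    abs_of_pos (by positivity), ← ENNReal.ofReal_mul (by positivity)]
  rw [one_div, inv_mul_cancel₀ (by positivity)]
  simp

/-! ### The Laplace transform as an isometry into the Hardy space -/

/-- `t ↦ f(t) e^{-xt}` on `(0,∞)`, extended by zero. -/
def laplaceSlice (f : ℝ → ℂ) (x : ℝ) : ℝ → ℂ :=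
  (Ioi (0 : ℝ)).indicator fun t => f t * Complex.exp (-(x : ℂ) * t)

theorem norm_exp_neg_mul (z : ℂ) (t : ℝ) : ‖Complex.exp (-z * t)‖ = Real.exp (-z.re * t) := by
  rw [Complex.norm_exp]; simp

theorem memLp_exp_neg_mul {z : ℂ} (hz : 0 < z.re) :
    MemLp (fun t : ℝ => Complex.exp (-z * t)) 2 (volume.restrict (Ioi 0)) := by
  rw [memLp_two_iff_integrable_sq_norm (by fun_prop)]
  simp only [norm_exp_neg_mul, ← Real.exp_nat_mul]
  have := integrableOn_exp_mul_Ioi (a := -(2 * z.re)) (by linarith) 0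
  refine this.congr_fun (fun t _ => ?_) measurableSet_Ioi
  simp only [Nat.cast_ofNat]
  ring_nf

theorem laplace_integrable (f : LTwoPos) {z : ℂ} (hz : 0 < z.re) :
    IntegrableOn (fun t : ℝ => f t * Complex.exp (-z * t)) (Ioi 0) :=
  (Lp.memLp f).integrable_mul (memLp_exp_neg_mul hz)

theorem laplaceSlice_integrable (f : LTwoPos) {x : ℝ} (hx : 0 < x) :
    Integrable (laplaceSlice f x) := by
  rw [laplaceSlice, integrable_indicator_iff measurableSet_Ioi]
  exact laplace_integrable f (z := x) (by simpa using hx)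

theorem eLpNorm_laplaceSlice (f : LTwoPos) (x : ℝ) : eLpNorm (laplaceSlice f x) 2 volume =
    eLpNorm (fun t => f t * Complex.exp (-(x : ℂ) * t)) 2 (volume.restrict (Ioi 0)) :=
  eLpNorm_indicator_eq_eLpNorm_restrict measurableSet_Ioi

theorem eLpNorm_mul_exp_le (f : LTwoPos) {x : ℝ} (hx : 0 ≤ x) :
    eLpNorm (fun t => f t * Complex.exp (-(x : ℂ) * t)) 2 (volume.restrict (Ioi 0)) ≤
      eLpNorm f 2 (volume.restrict (Ioi 0)) := by
  apply eLpNorm_mono_ae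
  filter_upwards [ae_restrict_mem measurableSet_Ioi] with t ht
  rw [norm_mul, norm_exp_neg_mul]
  apply mul_le_of_le_one_right (norm_nonneg _)
  rw [Real.exp_le_one_iff]
  simp only [Complex.ofReal_re, mem_Ioi] at ht ⊢
  nlinarith

theorem laplaceSlice_memLp (f : LTwoPos) {x : ℝ} (hx : 0 ≤ x) :
    MemLp (laplaceSlice f x) 2 := by
  refine ⟨?_, ?_⟩
  · rw [laplaceSlice, aestronglyMeasurable_indicator_iff measurableSet_Ioi]
    exact (Lp.aestronglyMeasurable f).mul (by fun_prop)
  · rw [eLpNorm_laplaceSlice]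
    exact (eLpNorm_mul_exp_le f hx).trans_lt (Lp.eLpNorm_lt_top f)

/-- On vertical lines the Laplace transform is a Fourier transform. -/
theorem laplace_line (f : ℝ → ℂ) (x y : ℝ) :
    laplace f (x + y * Complex.I) = 𝓕 (laplaceSlice f x) (y * (2 * Real.pi)⁻¹) := by
  rw [laplace, Real.fourier_eq', laplaceSlice, ← integral_indicator measurableSet_Ioi]
  congr 1
  ext t
  by_cases ht : t ∈ Ioi (0 : ℝ)
  · simp only [indicator_of_mem ht, smul_eq_mul]
    rw [mul_comm (Complex.exp _), mul_assoc, ← Complex.exp_add]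
    congr 2
    simp only [RCLike.inner_apply, conj_trivial]
    push_cast
    field_simp
    ring
  · simp [indicator_of_notMem ht]

theorem lineNorm_laplace (f : LTwoPos) {x : ℝ} (hx : 0 < x) :
    lineNorm (fun z => laplace f z) x =
      eLpNorm (fun t => f t * Complex.exp (-(x : ℂ) * t)) 2 (volume.restrict (Ioi 0)) := by
  have h : (fun y : ℝ => zeroExt (fun z => laplace f z) (x + y * Complex.I)) =
      𝓕 (laplaceSlice f x) ∘ fun y => y * (2 * Real.pi)⁻¹ := by
    ext y
    rw [zeroExt_apply _ (by simpa using hx), laplace_line]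
    rfl
  rw [lineNorm, h, eLpNorm_comp_measurePreserving _ measurePreserving_div_two_pi,
    eLpNorm_fourier_eq (laplaceSlice_integrable f hx) (laplaceSlice_memLp f hx.le),
    eLpNorm_laplaceSlice]
  exact (VectorFourier.fourierIntegral_continuous Real.continuous_fourierChar
      (by fun_prop) (laplaceSlice_integrable f hx)).aestronglyMeasurable

/-- By Plancherel, the norm on the line `Re z = x` is the `L₂` norm of `f(t) e^{-xt}`. It is at most
that of `f`, and Fatou's lemma along `x = 1/(n+1)` shows that the supremum loses nothing. -/
theorem hardyENorm_laplace (f : LTwoPos) :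
    hardyENorm (fun z => laplace f z) = eLpNorm f 2 (volume.restrict (Ioi 0)) := by
  apply le_antisymm
  · refine iSup₂_le fun x hx => ?_
    rw [lineNorm_laplace f hx]
    exact eLpNorm_mul_exp_le f (le_of_lt hx)
  · let u : ℕ → ℝ := fun n => 1 / ((n : ℝ) + 1)
    have hu : ∀ n, 0 < u n := fun n => by positivity
    refine (Lp.eLpNorm_lim_le_liminf_eLpNorm
      (f := fun n t => f t * Complex.exp (-(u n : ℂ) * t)) ?_ f ?_).trans ?_
    · exact fun n => (Lp.aestronglyMeasurable f).mul (by fun_prop)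
    · refine Filter.Eventually.of_forall fun t => ?_
      have : Filter.Tendsto (fun n => f t * Complex.exp (-(u n : ℂ) * t)) Filter.atTop
          (nhds (f t * Complex.exp (-((0 : ℝ) : ℂ) * t))) :=
        ((Continuous.tendsto (by fun_prop :
          Continuous fun a : ℝ => f t * Complex.exp (-(a : ℂ) * t)) 0).comp
            tendsto_one_div_add_atTop_nhds_zero_nat)
      simpa using this
    · refine Filter.liminf_le_of_frequently_le' (Filter.Frequently.of_forall fun n => ?_)
      rw [← lineNorm_laplace f (hu n)]
      exact lineNorm_le _ (hu n)

theorem memLp_mul_exp_neg_mul {a : ℝ} (ha : 0 < a) :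
    MemLp (fun t : ℝ => ((t * Real.exp (-a * t) : ℝ) : ℂ)) 2 (volume.restrict (Ioi 0)) := by
  rw [memLp_two_iff_integrable_sq_norm (by fun_prop)]
  have h := integrableOn_rpow_mul_exp_neg_mul_rpow (s := 2) (p := 1) (b := 2 * a)
    (by norm_num) one_pos (by positivity)
  refine h.congr_fun (fun t ht => ?_) measurableSet_Ioi
  simp only [Complex.norm_real, Real.norm_eq_abs, sq_abs, mul_pow, ← Real.exp_nat_mul, Real.rpow_one,
    Real.rpow_ofNat]
  push_cast
  ring_nf

theorem differentiableAt_laplace (f : LTwoPos) {z : ℂ} (hz : 0 < z.re) :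
    DifferentiableAt ℂ (laplace f) z := by
  have hb : Integrable (fun t : ℝ => f t * ((t * Real.exp (-(z.re / 2) * t) : ℝ) : ℂ))
      (volume.restrict (Ioi 0)) :=
    (Lp.memLp f).integrable_mul (memLp_mul_exp_neg_mul (half_pos hz))
  refine (hasDerivAt_integral_of_dominated_loc_of_deriv_le (𝕜 := ℂ)
    (F' := fun w t => f t * (Complex.exp (-w * t) * (-1 * t)))
    (bound := fun t : ℝ => ‖f t * ((t * Real.exp (-(z.re / 2) * t) : ℝ) : ℂ)‖)
    (s := {w | z.re / 2 < w.re}) ?_ ?_ ?_ ?_ ?_ hb.norm ?_).2.differentiableAt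
  · exact (isOpen_lt continuous_const Complex.continuous_re).mem_nhds (by simp; linarith)
  · exact Filter.Eventually.of_forall fun w => (Lp.aestronglyMeasurable f).mul (by fun_prop)
  · exact laplace_integrable f hz
  · exact (Lp.aestronglyMeasurable f).mul (by fun_prop)
  · filter_upwards [ae_restrict_mem measurableSet_Ioi] with t ht w hw
    simp only [mem_Ioi] at ht
    simp only [norm_mul, norm_exp_neg_mul, Complex.norm_real, norm_neg, norm_one, one_mul,
      Complex.ofReal_mul, Real.norm_eq_abs, abs_of_pos ht, Real.abs_exp]
    rw [mul_comm (Real.exp _)]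
    gcongr
  · refine Filter.Eventually.of_forall fun t w _ => ?_
    exact ((((hasDerivAt_id w).neg).mul_const (t : ℂ)).cexp).const_mul _

theorem isHolo_laplace (f : LTwoPos) : IsHolo (fun z => laplace f z) := by
  have : DifferentiableOn ℂ (laplace f) {z | 0 < z.re} := fun z hz =>
    (differentiableAt_laplace f hz).differentiableWithinAt
  exact this.congr fun z hz => zeroExt_apply _ hz

theorem laplace_eq_of_ae {f g : ℝ → ℂ} (h : f =ᵐ[volume.restrict (Ioi 0)] g) (z : ℂ) :
    laplace f z = laplace g z := by
  apply integral_congr_ae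
  filter_upwards [h] with t ht
  rw [ht]

/-- The Laplace transform as an isometry of `L₂(ℝ⁺)` into `H₂(ℂ⁺)`. -/
def laplaceIsometry : LTwoPos →ₗᵢ[ℂ] HardyTwo where
  toFun f := ⟨fun z => laplace f z, isHolo_laplace f, by
    rw [hardyENorm_laplace]; exact Lp.eLpNorm_lt_top f⟩
  map_add' f g := HardyTwo.ext fun z => by
    refine (laplace_eq_of_ae (Lp.coeFn_add f g) z).trans ?_
    refine Eq.trans ?_ (integral_add (laplace_integrable f z.2) (laplace_integrable g z.2))
    simp only [laplace, Pi.add_apply, add_mul]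
  map_smul' c f := HardyTwo.ext fun z => by
    refine (laplace_eq_of_ae (Lp.coeFn_smul c f) z).trans ?_
    refine Eq.trans ?_ (integral_const_mul c _)
    simp only [laplace, Pi.smul_apply, smul_eq_mul, mul_assoc]
  norm_map' f := by
    change (hardyENorm (fun z => laplace f z)).toReal = _
    rw [hardyENorm_laplace, Lp.norm_def]

theorem laplaceIsometry_apply (f : LTwoPos) (z : CPlus) : laplaceIsometry f z = laplace f z := rfl

/-- The exponential `t ↦ e^{-z̄ t}` in `L₂(ℝ⁺)`. -/
def expVec (z : CPlus) : LTwoPos :=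
  (memLp_exp_neg_mul (z := conj (z : ℂ)) (by simpa using z.2)).toLp _

theorem coeFn_expVec (z : CPlus) : expVec z =ᵐ[volume.restrict (Ioi 0)]
    fun t : ℝ => Complex.exp (-conj (z : ℂ) * t) := MemLp.coeFn_toLp _

/-- Point evaluations of Laplace transforms become inner products; both the density arguments and
the kernel computation rest on this. -/
theorem inner_expVec (z : CPlus) (f : LTwoPos) : inner ℂ (expVec z) f = laplaceIsometry f z := by
  rw [L2.inner_def, laplaceIsometry_apply, laplace]
  apply integral_congr_ae
  filter_upwards [coeFn_expVec z] with t ht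
  rw [ht, RCLike.inner_apply, ← Complex.exp_conj]
  simp

/-! ### Cauchy's integral formula on vertical lines -/

theorem continuous_vertical (x : ℝ) : Continuous fun y : ℝ => (x : ℂ) + y * Complex.I := by fun_prop

/-- Cauchy's theorem for a strip: vertical line integrals of an integrable holomorphic function
agree. -/
theorem integral_vertical_eq {H : ℂ → ℂ} {x X : ℝ} (hxX : x ≤ X)
    (hH : DifferentiableOn ℂ H {w | x ≤ w.re})
    (hx : Integrable fun y : ℝ => H (x + y * Complex.I))
    (hX : Integrable fun y : ℝ => H (X + y * Complex.I))
    (hs : Integrable (fun q : ℝ × ℝ => H (q.1 + q.2 * Complex.I))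
      ((volume.restrict (Ioc x X)).prod volume)) :
    ∫ y : ℝ, H (x + y * Complex.I) = ∫ y : ℝ, H (X + y * Complex.I) := by
  let h : ℝ → ℂ := fun R => ∫ σ in x..X, H (σ + R * Complex.I)
  have hh : Integrable h := by
    have := hs.integral_prod_right
    simpa only [h, intervalIntegral.integral_of_le hxX] using this
  let D : ℝ → ℂ := fun R => (∫ y in (-R)..R, H (X + y * Complex.I)) -
    ∫ y in (-R)..R, H (x + y * Complex.I)
  have hD : D = fun R => Complex.I * (h (-R) - h R) := by
    ext R
    have := Complex.integral_boundary_rect_eq_zero_of_differentiableOn H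
      (x + (-R : ℝ) * Complex.I) (X + R * Complex.I) (hH.mono ?_)
    · simp only [Complex.add_re, Complex.ofReal_re, Complex.mul_re, Complex.I_re, mul_zero,
        Complex.ofReal_im, Complex.I_im, mul_one, sub_self, add_zero, Complex.add_im,
        Complex.mul_im, zero_add, smul_eq_mul] at this
      simp only [D, h]
      linear_combination (-Complex.I) * this +
        (∫ y in (-R)..R, H (X + y * Complex.I)) * Complex.I_sq -
        (∫ y in (-R)..R, H (x + y * Complex.I)) * Complex.I_sq
    · intro w hw
      have := hw.1
      simp only [Complex.add_re, Complex.ofReal_re, Complex.mul_re, Complex.I_re, mul_zero,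
        Complex.ofReal_im, Complex.I_im, mul_one, sub_self, add_zero, mem_preimage,
        uIcc_of_le hxX] at this
      exact this.1
  have hDi : Integrable D := by
    rw [hD]
    exact (hh.comp_neg.sub hh).const_mul _
  have hlim : Tendsto D atTop (𝓝 ((∫ y : ℝ, H (X + y * Complex.I)) -
      ∫ y : ℝ, H (x + y * Complex.I))) :=
    (intervalIntegral_tendsto_integral hX tendsto_neg_atTop_atBot tendsto_id).sub
      (intervalIntegral_tendsto_integral hx tendsto_neg_atTop_atBot tendsto_id)
  -- No pointwise decay of `H` is needed for the horizontal sides: their contribution `D` is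
  -- integrable in the height `R` and has a limit as `R → ∞`, so that limit must be `0`.
  have := IntegrableAtFilter.eq_zero_of_tendsto (hDi.integrableAtFilter atTop) ?_ hlim
  · exact (sub_eq_zero.1 this).symm
  · intro s hs
    obtain ⟨b, hb⟩ := mem_atTop_sets.1 hs
    rw [← top_le_iff, ← Real.volume_Ici (a := b)]
    exact measure_mono hb

theorem integrable_inv_sq_add_sub_sq {a : ℝ} (ha : 0 < a) (b : ℝ) :
    Integrable (fun y : ℝ => (a ^ 2 + (y - b) ^ 2)⁻¹) := by
  have h := ((integrable_inv_one_add_sq.comp_div ha.ne').comp_sub_right b).const_mul (a⁻¹ ^ 2)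
  refine h.congr (Eventually.of_forall fun y => ?_)
  simp only
  field_simp

/-- The Poisson kernel integral. -/
theorem integral_inv_sq_add_sub_sq {a : ℝ} (ha : 0 < a) (b : ℝ) :
    ∫ y : ℝ, (a ^ 2 + (y - b) ^ 2)⁻¹ = Real.pi / a := by
  have h : (fun y : ℝ => (a ^ 2 + (y - b) ^ 2)⁻¹) =
      fun y => (fun u : ℝ => a⁻¹ ^ 2 * (fun v : ℝ => (1 + v ^ 2)⁻¹) (u / a)) (y - b) := by
    ext y
    simp only
    field_simp
  rw [h, integral_sub_right_eq_self (fun u : ℝ => a⁻¹ ^ 2 * (fun v : ℝ => (1 + v ^ 2)⁻¹) (u / a)) b,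
    integral_const_mul, Measure.integral_comp_div (fun v : ℝ => (1 + v ^ 2)⁻¹),
    integral_univ_inv_one_add_sq, abs_of_pos ha, smul_eq_mul]
  field_simp

theorem norm_sq_vertical_sub (X y : ℝ) (p : ℂ) :
    ‖(X + y * Complex.I : ℂ) - p‖ ^ 2 = (X - p.re) ^ 2 + (y - p.im) ^ 2 := by
  rw [← Complex.normSq_eq_norm_sq, Complex.normSq_apply]
  simp
  ring

theorem dslope_eq_div {g : ℂ → ℂ} {p w : ℂ} (hp : g p = 0) (hw : w ≠ p) :
    dslope g p w = g w / (w - p) := by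
  rw [dslope_of_ne _ hw, slope_def_field, hp, sub_zero]

/-- The inequality `AB ≤ εA² + ε⁻¹B²` with `A = ‖g(w)‖` and `B = ‖w - p‖⁻¹`. The free parameter `ε`
is what later forces decay as the line moves to the right. -/
theorem norm_dslope_le {g : ℂ → ℂ} {p : ℂ} (hp : g p = 0) {X y : ℝ} {d : ℝ} (hd : 0 < d)
    (h : d ^ 2 ≤ (X - p.re) ^ 2 + (y - p.im) ^ 2) {ε : ℝ} (hε : 0 < ε) :
    ‖dslope g p (X + y * Complex.I)‖ ≤ ε * ‖g (X + y * Complex.I)‖ ^ 2 +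
      ε⁻¹ * ((X - p.re) ^ 2 + (y - p.im) ^ 2)⁻¹ := by
  rw [← norm_sq_vertical_sub] at h ⊢
  set w : ℂ := X + y * Complex.I
  have hpos : 0 < ‖w - p‖ := by
    by_contra hh
    have h0 : ‖w - p‖ = 0 := le_antisymm (not_lt.1 hh) (norm_nonneg _)
    rw [h0] at h
    nlinarith
  have hw : w ≠ p := fun h => by simp [h] at hpos
  rw [dslope_eq_div hp hw, norm_div, div_eq_mul_inv, ← inv_pow]
  set A := ‖g w‖
  set B := ‖w - p‖⁻¹
  have h1 : 0 ≤ ε * A ^ 2 := by positivity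
  have h2 : 0 ≤ ε⁻¹ * B ^ 2 := by positivity
  have h3 : 0 ≤ (ε * A - B) ^ 2 * ε⁻¹ := by positivity
  have h4 : (ε * A - B) ^ 2 * ε⁻¹ = ε * A ^ 2 - 2 * (A * B) + ε⁻¹ * B ^ 2 := by
    field_simp
    ring
  nlinarith

theorem integrable_dslope_line {g : ℂ → ℂ} {x X : ℝ} {p : ℂ}
    (hg : DifferentiableOn ℂ g {w | x ≤ w.re}) (hp : g p = 0) (hpx : x < p.re) (hX : x ≤ X)
    (hXp : X ≠ p.re) (hi : Integrable fun y : ℝ => ‖g (X + y * Complex.I)‖ ^ 2) :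
    Integrable fun y : ℝ => dslope g p (X + y * Complex.I) := by
  have hnhds : {w : ℂ | x ≤ w.re} ∈ 𝓝 p :=
    mem_of_superset ((isOpen_lt continuous_const Complex.continuous_re).mem_nhds hpx)
      fun w (hw : x < w.re) => hw.le
  have hH := (Complex.differentiableOn_dslope hnhds).2 hg
  have hd : 0 < |X - p.re| := abs_pos.2 (sub_ne_zero.2 hXp)
  refine Integrable.mono' ((hi.const_mul 1).add
    ((integrable_inv_sq_add_sub_sq hd p.im).const_mul 1⁻¹)) ?_ ?_
  · refine Continuous.aestronglyMeasurable ?_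
    exact hH.continuousOn.comp_continuous (continuous_vertical X) fun y => by simpa using hX
  · refine Eventually.of_forall fun y => ?_
    have := norm_dslope_le hp hd (X := X) (y := y) (by rw [sq_abs]; nlinarith [sq_nonneg (y - p.im)])
      one_pos
    simpa [sq_abs] using this

theorem integral_norm_dslope_line_le {g : ℂ → ℂ} {X M : ℝ} {p : ℂ}
    (hp : g p = 0) (hXp : p.re < X) (hi : Integrable fun y : ℝ => ‖g (X + y * Complex.I)‖ ^ 2)
    (hM : ∫ y : ℝ, ‖g (X + y * Complex.I)‖ ^ 2 ≤ M) :
    ‖∫ y : ℝ, dslope g p (X + y * Complex.I)‖ ≤ (M + Real.pi) * (√(X - p.re))⁻¹ := by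
  have hd : 0 < X - p.re := sub_pos.2 hXp
  have hr : 0 < √(X - p.re) := Real.sqrt_pos.2 hd
  set r := √(X - p.re) with hrdef
  have hrr : r ^ 2 = X - p.re := Real.sq_sqrt hd.le
  have hint := (hi.const_mul r⁻¹).add ((integrable_inv_sq_add_sub_sq hd p.im).const_mul r⁻¹⁻¹)
  have hle : ‖∫ y : ℝ, dslope g p (X + y * Complex.I)‖ ≤ ∫ y : ℝ, (r⁻¹ *
      ‖g (X + y * Complex.I)‖ ^ 2 + r⁻¹⁻¹ * ((X - p.re) ^ 2 + (y - p.im) ^ 2)⁻¹) := by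
    refine norm_integral_le_of_norm_le hint (Eventually.of_forall fun y => ?_)
    -- The choice `ε = (X - Re p)^{-1/2}` balances the terms: `εM` and `ε⁻¹π/(X - Re p)` are both of
    -- order `(X - Re p)^{-1/2}`.
    exact norm_dslope_le hp hd (by nlinarith [sq_nonneg (y - p.im)]) (inv_pos.2 hr)
  refine hle.trans ?_
  rw [integral_add (hi.const_mul _) ((integrable_inv_sq_add_sub_sq hd p.im).const_mul _),
    integral_const_mul, integral_const_mul, integral_inv_sq_add_sub_sq hd, ← hrr]
  have : r⁻¹⁻¹ * (Real.pi / r ^ 2) = Real.pi * r⁻¹ := by field_simp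
  rw [this, add_mul, mul_comm]
  gcongr

/-- Uniform `L₂` bounds on the lines make `‖g‖²` integrable over the strip. The divided difference
is dominated by `‖g‖²` plus a multiple of `1/(1 + (y - Im p)²)`. -/
theorem integrable_dslope_strip {g : ℂ → ℂ} {x X M : ℝ} {p : ℂ}
    (hg : DifferentiableOn ℂ g {w | x ≤ w.re}) (hp : g p = 0) (hpx : x < p.re)
    (hi : ∀ σ, x ≤ σ → Integrable fun y : ℝ => ‖g (σ + y * Complex.I)‖ ^ 2)
    (hM : ∀ σ, x ≤ σ → ∫ y : ℝ, ‖g (σ + y * Complex.I)‖ ^ 2 ≤ M) :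
    Integrable (fun q : ℝ × ℝ => dslope g p (q.1 + q.2 * Complex.I))
      ((volume.restrict (Ioc x X)).prod volume) := by
  have hnhds : {w : ℂ | x ≤ w.re} ∈ 𝓝 p :=
    mem_of_superset ((isOpen_lt continuous_const Complex.continuous_re).mem_nhds hpx)
      fun w (hw : x < w.re) => hw.le
  have hH := (Complex.differentiableOn_dslope hnhds).2 hg
  have hmap : Continuous fun q : ℝ × ℝ => (q.1 : ℂ) + q.2 * Complex.I := by fun_prop
  have hprod : (volume.restrict (Ioc x X)).prod (volume : Measure ℝ) =
      (volume : Measure (ℝ × ℝ)).restrict (Ioc x X ×ˢ univ) := by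
    rw [Measure.volume_eq_prod, ← Measure.prod_restrict, Measure.restrict_univ]
  have hmaps : MapsTo (fun q : ℝ × ℝ => (q.1 : ℂ) + q.2 * Complex.I) (Ioc x X ×ˢ univ)
      {w | x ≤ w.re} := fun q hq => by simpa using hq.1.1.le
  have hms : MeasurableSet (Ioc x X ×ˢ (univ : Set ℝ)) := measurableSet_Ioc.prod MeasurableSet.univ
  have hmeas : ∀ {f : ℂ → ℂ}, ContinuousOn f {w | x ≤ w.re} → AEStronglyMeasurable
      (fun q : ℝ × ℝ => f (q.1 + q.2 * Complex.I)) ((volume.restrict (Ioc x X)).prod volume) := by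
    intro f hf
    rw [hprod]
    exact (hf.comp hmap.continuousOn hmaps).aestronglyMeasurable hms
  have hgi : Integrable (fun q : ℝ × ℝ => ‖g (q.1 + q.2 * Complex.I)‖ ^ 2)
      ((volume.restrict (Ioc x X)).prod volume) := by
    have hm : AEStronglyMeasurable (fun q : ℝ × ℝ => ‖g (q.1 + q.2 * Complex.I)‖ ^ 2)
        ((volume.restrict (Ioc x X)).prod volume) := (hmeas hg.continuousOn).norm.pow 2
    rw [integrable_prod_iff hm]
    constructor
    · filter_upwards [ae_restrict_mem measurableSet_Ioc] with σ hσ using hi σ hσ.1.le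
    · refine Integrable.mono' (integrable_const M) ?_ ?_
      · exact hm.norm.integral_prod_right'
      · filter_upwards [ae_restrict_mem measurableSet_Ioc] with σ hσ
        simp only [norm_pow, norm_norm]
        rw [Real.norm_of_nonneg (integral_nonneg fun y => by positivity)]
        exact hM σ hσ.1.le
  have hpi : Integrable (fun q : ℝ × ℝ => (1 ^ 2 + (q.2 - p.im) ^ 2)⁻¹)
      ((volume.restrict (Ioc x X)).prod volume) := by
    have := (integrable_const (1 : ℝ) (μ := volume.restrict (Ioc x X))).mul_prod
      (integrable_inv_sq_add_sub_sq one_pos p.im)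
    simpa using this
  obtain ⟨K, hK⟩ := ((isCompact_Icc (a := x) (b := X)).prod
    (isCompact_Icc (a := p.im - 1) (b := p.im + 1))).exists_bound_of_continuousOn
    (f := fun q : ℝ × ℝ => dslope g p (q.1 + q.2 * Complex.I))
    (hH.continuousOn.comp hmap.continuousOn fun q hq => by simpa using hq.1.1)
  refine Integrable.mono' (hgi.add (hpi.const_mul (2 * |K| + 2))) (hmeas hH.continuousOn) ?_
  rw [hprod]
  filter_upwards [ae_restrict_mem hms] with q hq
  simp only [Pi.add_apply]
  have hv : 0 ≤ (q.2 - p.im) ^ 2 := sq_nonneg _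
  -- At heights within `1` of `p` the bound is continuity on a compact rectangle, where the majorant
  -- is at least `|K| + 1`. Elsewhere the distance to `p` is at least `1` and the inequality with `ε
  -- = 1` applies.
  by_cases hq1 : |q.2 - p.im| ≤ 1
  · have h1 := hK q ⟨⟨hq.1.1.le, hq.1.2⟩, by
      rw [abs_le] at hq1; constructor <;> linarith [hq1.1, hq1.2]⟩
    have h2 : 1 / 2 ≤ (1 ^ 2 + (q.2 - p.im) ^ 2)⁻¹ := by
      rw [← sq_le_one_iff_abs_le_one] at hq1
      rw [le_inv_comm₀ (by norm_num) (by positivity)]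
      norm_num
      linarith
    have h3 : 0 ≤ ‖g (q.1 + q.2 * Complex.I)‖ ^ 2 := by positivity
    have h4 := le_abs_self K
    nlinarith [abs_nonneg K]
  · have hq2 : 1 < (q.2 - p.im) ^ 2 := by
      rw [not_le] at hq1
      rw [← sq_abs]; nlinarith
    have h1 := norm_dslope_le hp one_pos (X := q.1) (y := q.2)
      (by nlinarith [sq_nonneg (q.1 - p.re)]) one_pos
    have h2 : ((q.1 - p.re) ^ 2 + (q.2 - p.im) ^ 2)⁻¹ ≤ 2 * (1 ^ 2 + (q.2 - p.im) ^ 2)⁻¹ := by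
      rw [← div_eq_mul_inv, inv_le_comm₀ (by nlinarith [sq_nonneg (q.1 - p.re)]) (by positivity),
        inv_div]
      nlinarith [sq_nonneg (q.1 - p.re)]
    have h3 : 0 ≤ |K| * (1 ^ 2 + (q.2 - p.im) ^ 2)⁻¹ := by positivity
    simp only [one_mul, inv_one] at h1
    nlinarith

/-- For a function with bounded `L₂`-norms on vertical lines that vanishes at `p`, the integral of
`g(w)/(w-p)` on any vertical line to the left of `p` vanishes. -/
theorem integral_dslope_eq_zero {g : ℂ → ℂ} {x M : ℝ} {p : ℂ}
    (hg : DifferentiableOn ℂ g {w | x ≤ w.re}) (hp : g p = 0) (hpx : x < p.re)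
    (hi : ∀ σ, x ≤ σ → Integrable fun y : ℝ => ‖g (σ + y * Complex.I)‖ ^ 2)
    (hM : ∀ σ, x ≤ σ → ∫ y : ℝ, ‖g (σ + y * Complex.I)‖ ^ 2 ≤ M) :
    ∫ y : ℝ, dslope g p (x + y * Complex.I) = 0 := by
  have hnhds : {w : ℂ | x ≤ w.re} ∈ 𝓝 p :=
    mem_of_superset ((isOpen_lt continuous_const Complex.continuous_re).mem_nhds hpx)
      fun w (hw : x < w.re) => hw.le
  have hH := (Complex.differentiableOn_dslope hnhds).2 hg
  have hle : ∀ X, p.re < X → ‖∫ y : ℝ, dslope g p (x + y * Complex.I)‖ ≤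
      (M + Real.pi) * (√(X - p.re))⁻¹ := by
    intro X hX
    have hxX : x ≤ X := (hpx.trans hX).le
    rw [integral_vertical_eq hxX hH
      (integrable_dslope_line hg hp hpx le_rfl hpx.ne (hi x le_rfl))
      (integrable_dslope_line hg hp hpx hxX hX.ne' (hi X hxX))
      (integrable_dslope_strip hg hp hpx hi hM)]
    exact integral_norm_dslope_line_le hp hX (hi X hxX) (hM X hxX)
  have hlim : Tendsto (fun X => (M + Real.pi) * (√(X - p.re))⁻¹) atTop (𝓝 0) := by
    rw [← mul_zero (M + Real.pi)]
    refine Tendsto.const_mul _ (Tendsto.inv_tendsto_atTop ?_)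
    exact Real.tendsto_sqrt_atTop.comp (tendsto_atTop_add_const_right _ _ tendsto_id)
  rw [← norm_le_zero_iff]
  exact ge_of_tendsto hlim (by filter_upwards [eventually_gt_atTop p.re] with X hX using hle X hX)

theorem integral_norm_sq_le_of_eLpNorm_le {α : Type*} {m : MeasurableSpace α} {μ : Measure α}
    {f : α → ℂ} (hf : MemLp f 2 μ) {C : ℝ} (hC : 0 ≤ C) (h : eLpNorm f 2 μ ≤ ENNReal.ofReal C) :
    ∫ y, ‖f y‖ ^ 2 ∂μ ≤ C ^ 2 := by
  rw [hf.eLpNorm_eq_integral_rpow_norm (by norm_num) (by norm_num),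
    ENNReal.ofReal_le_ofReal_iff hC] at h
  simp only [ENNReal.toReal_ofNat, Real.rpow_ofNat] at h
  rw [← one_div, ← Real.sqrt_eq_rpow] at h
  exact (Real.sqrt_le_left hC).1 h

/-- The rescaled restriction `ξ ↦ F(x + 2πiξ)` to a vertical line. -/
def lineSlice (F : CPlus → ℂ) (x : ℝ) (ξ : ℝ) : ℂ :=
  zeroExt F (x + ((ξ * (2 * Real.pi) : ℝ) : ℂ) * Complex.I)

theorem continuous_lineSlice {F : CPlus → ℂ} (hF : IsHolo F) {x : ℝ} (hx : 0 < x) :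
    Continuous (lineSlice F x) :=
  (hF.continuous_line hx).comp (by fun_prop : Continuous fun ξ : ℝ => ξ * (2 * Real.pi))

theorem eLpNorm_lineSlice {F : CPlus → ℂ} (hF : IsHolo F) {x : ℝ} (hx : 0 < x) :
    eLpNorm (lineSlice F x) 2 volume = lineNorm F x := by
  rw [← eLpNorm_comp_measurePreserving (continuous_lineSlice hF hx).aestronglyMeasurable
    measurePreserving_div_two_pi, lineNorm]
  congr 1
  ext y
  simp only [lineSlice, Function.comp]
  rw [inv_mul_cancel_right₀ (by positivity)]

theorem memLp_lineSlice (F : HardyTwo) {x : ℝ} (hx : 0 < x) : MemLp (lineSlice F x) 2 :=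
  ⟨(continuous_lineSlice F.2.1 hx).aestronglyMeasurable, by
    rw [eLpNorm_lineSlice F.2.1 hx]
    exact (lineNorm_le F hx).trans_lt F.2.2⟩

theorem integrable_norm_sq_line (F : HardyTwo) {x : ℝ} (hx : 0 < x) :
    Integrable fun y : ℝ => ‖zeroExt F (x + y * Complex.I)‖ ^ 2 := by
  have h := ((memLp_two_iff_integrable_sq_norm
    (memLp_lineSlice F hx).1).1 (memLp_lineSlice F hx)).comp_mul_right'
      (R := (2 * Real.pi)⁻¹) (by positivity)
  refine h.congr (Eventually.of_forall fun y => ?_)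
  simp only [lineSlice]
  rw [inv_mul_cancel_right₀ (by positivity)]

theorem integral_norm_sq_line_le (F : HardyTwo) {x : ℝ} (hx : 0 < x) :
    ∫ y : ℝ, ‖zeroExt F (x + y * Complex.I)‖ ^ 2 ≤ 2 * Real.pi * ‖F‖ ^ 2 := by
  have h1 : ∫ ξ : ℝ, ‖lineSlice F x ξ‖ ^ 2 ≤ ‖F‖ ^ 2 := by
    refine integral_norm_sq_le_of_eLpNorm_le (memLp_lineSlice F hx) (norm_nonneg _) ?_
    rw [eLpNorm_lineSlice F.2.1 hx, HardyTwo.norm_def, ENNReal.ofReal_toReal F.2.2.ne]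
    exact lineNorm_le F hx
  have h2 := Measure.integral_comp_mul_right
    (fun y : ℝ => ‖zeroExt F (x + y * Complex.I)‖ ^ 2) (2 * Real.pi)
  rw [abs_of_pos (by positivity), smul_eq_mul] at h2
  simp only [lineSlice] at h1
  rw [h2, inv_mul_le_iff₀ (by positivity)] at h1
  exact h1

/-- Cauchy's integral formula for `H₂(ℂ⁺)`. -/
theorem cauchy_integral_line (F : HardyTwo) {x : ℝ} (hx : 0 < x) {z : ℂ} (hz : 0 < z.re) :
    ∫ y : ℝ, zeroExt F (x + y * Complex.I) / (z - y * Complex.I) =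
      2 * Real.pi * zeroExt F (x + z) := by
  -- The point `q` is the reflection of `p` in the line `Re w = x`. Subtracting `c/(w - q)`, which
  -- is holomorphic to the right of that line, makes `g` vanish at `p` without spoiling the `L₂`
  -- bounds.
  set p : ℂ := x + z with hpdef
  set q : ℂ := x - conj z with hqdef
  have hqre : q.re = x - z.re := by simp [q]
  have hqim : q.im = z.im := by simp [q]
  have hpre : p.re = x + z.re := by simp [p]
  set c : ℂ := zeroExt F p * (2 * z.re) with hc
  let g : ℂ → ℂ := fun w => zeroExt F w - c / (w - q)
  have hne : ∀ w : ℂ, x ≤ w.re → w - q ≠ 0 := fun w hw h => by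
    have := congrArg Complex.re h
    rw [Complex.sub_re, hqre, Complex.zero_re] at this
    linarith
  have hg : DifferentiableOn ℂ g {w | x ≤ w.re} := by
    refine DifferentiableOn.sub (F.2.1.mono fun w hw => hx.trans_le hw) ?_
    exact DifferentiableOn.div (differentiableOn_const _)
      (differentiableOn_id.sub (differentiableOn_const _)) hne
  have hpq : p - q = 2 * z.re := by
    have h := Complex.add_conj z
    push_cast at h
    rw [hpdef, hqdef]
    linear_combination h
  have hzc : (2 * z.re : ℂ) ≠ 0 := by
    have : (z.re : ℂ) ≠ 0 := by exact_mod_cast hz.ne'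
    simpa using this
  have hgp : g p = 0 := by
    simp only [g, hc]
    rw [hpq, mul_div_cancel_right₀ _ hzc, sub_self]
  have hpx : x < p.re := by rw [hpre]; linarith
  have hbound : ∀ σ, x ≤ σ → ∀ y : ℝ, ‖g (σ + y * Complex.I)‖ ^ 2 ≤
      2 * ‖zeroExt F (σ + y * Complex.I)‖ ^ 2 +
        2 * ‖c‖ ^ 2 * (z.re ^ 2 + (y - z.im) ^ 2)⁻¹ := by
    intro σ hσ y
    have h1 : ‖c / (σ + y * Complex.I - q)‖ ^ 2 ≤ ‖c‖ ^ 2 * (z.re ^ 2 + (y - z.im) ^ 2)⁻¹ := by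
      rw [norm_div, div_pow, norm_sq_vertical_sub, hqre, hqim, div_eq_mul_inv]
      gcongr
      linarith
    have h2 := norm_sub_le (zeroExt F (σ + y * Complex.I)) (c / (σ + y * Complex.I - q))
    have h3 : ‖g (σ + y * Complex.I)‖ ^ 2 ≤ (‖zeroExt F (σ + y * Complex.I)‖ +
      ‖c / (σ + y * Complex.I - q)‖) ^ 2 := pow_le_pow_left₀ (norm_nonneg _) h2 2
    nlinarith [sq_nonneg (‖zeroExt F (σ + y * Complex.I)‖ - ‖c / (σ + y * Complex.I - q)‖)]
  have hint : ∀ σ, x ≤ σ → Integrable fun y : ℝ => 2 * ‖zeroExt F (σ + y * Complex.I)‖ ^ 2 +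
        2 * ‖c‖ ^ 2 * (z.re ^ 2 + (y - z.im) ^ 2)⁻¹ := fun σ hσ =>
    ((integrable_norm_sq_line F (hx.trans_le hσ)).const_mul 2).add
      ((integrable_inv_sq_add_sub_sq hz z.im).const_mul _)
  have hi : ∀ σ, x ≤ σ → Integrable fun y : ℝ => ‖g (σ + y * Complex.I)‖ ^ 2 := by
    intro σ hσ
    refine (hint σ hσ).mono' ?_ (Eventually.of_forall fun y => ?_)
    · refine Continuous.aestronglyMeasurable ?_
      exact (hg.continuousOn.comp_continuous (continuous_vertical σ)
        fun y => by simpa using hσ).norm.pow 2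
    · rw [Real.norm_of_nonneg (by positivity)]
      exact hbound σ hσ y
  have hM : ∀ σ, x ≤ σ → ∫ y : ℝ, ‖g (σ + y * Complex.I)‖ ^ 2 ≤
      2 * (2 * Real.pi * ‖F‖ ^ 2) + 2 * ‖c‖ ^ 2 * (Real.pi / z.re) := by
    intro σ hσ
    refine (integral_mono (hi σ hσ) (hint σ hσ) (hbound σ hσ)).trans ?_
    rw [integral_add ((integrable_norm_sq_line F (hx.trans_le hσ)).const_mul 2)
      ((integrable_inv_sq_add_sub_sq hz z.im).const_mul _), integral_const_mul, integral_const_mul,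
      integral_inv_sq_add_sub_sq hz]
    gcongr
    exact integral_norm_sq_line_le F (hx.trans_le hσ)
  have h0 := integral_dslope_eq_zero hg hgp hpx hi hM
  have hid := integrable_dslope_line hg hgp hpx le_rfl hpx.ne (hi x le_rfl)
  have hpt : ∀ y : ℝ, zeroExt F (x + y * Complex.I) / (z - y * Complex.I) =
      -dslope g p (x + y * Complex.I) + c * (((z.re ^ 2 + (y - z.im) ^ 2)⁻¹ : ℝ) : ℂ) := by
    intro y
    have hz1 : z - y * Complex.I ≠ 0 := fun h => by
      have := congrArg Complex.re h
      simp at this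
      exact hz.ne' this
    have hz2 : conj z + y * Complex.I ≠ 0 := fun h => by
      have := congrArg Complex.re h
      simp at this
      exact hz.ne' this
    rw [dslope_eq_div hgp fun h => by
      have := congrArg Complex.re h
      simp [hpre] at this
      exact hz.ne' this]
    have hn : (((z.re ^ 2 + (y - z.im) ^ 2) : ℝ) : ℂ) =
        (z - y * Complex.I) * (conj z + y * Complex.I) := by
      apply Complex.ext
      · rw [Complex.ofReal_re]
        simp
        ring
      · rw [Complex.ofReal_im]
        simp
        ring
    rw [Complex.ofReal_inv, hn]
    have e1 : (x + y * Complex.I : ℂ) - p = -(z - y * Complex.I) := by rw [hpdef]; ring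
    have e2 : (x + y * Complex.I : ℂ) - q = conj z + y * Complex.I := by rw [hqdef]; ring
    simp only [g]
    rw [e1, e2]
    field_simp
    ring
  -- On the line, `w - p` and `w - q` are, up to sign, complex conjugates, so the correction term is
  -- a Poisson kernel. Its integral `cπ/Re z` is `2πF(x + z)`, while the divided difference
  -- integrates to `0`.
  simp only [hpt]
  have hP : ∫ y : ℝ, (((z.re ^ 2 + (y - z.im) ^ 2)⁻¹ : ℝ) : ℂ) = ((Real.pi / z.re : ℝ) : ℂ) := by
    rw [integral_complex_ofReal, integral_inv_sq_add_sub_sq hz]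
  refine (integral_add hid.neg
    (((integrable_inv_sq_add_sub_sq hz z.im).ofReal (𝕜 := ℂ)).const_mul c)).trans ?_
  rw [integral_neg', h0, integral_const_mul]
  refine (congrArg (fun s : ℂ => -0 + c * s) hP).trans ?_
  simp only [hc]
  have : (z.re : ℂ) ≠ 0 := by exact_mod_cast hz.ne'
  push_cast
  field_simp
  ring

/-! ### Surjectivity of the Laplace transform: the Paley-Wiener theorem -/

/-- The exponential `t ↦ e^{-wt}` on `(0,∞)`, extended by zero. -/
def expSlice (w : ℂ) : ℝ → ℂ := (Ioi (0 : ℝ)).indicator fun t => Complex.exp (-w * t)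

theorem memLp_expSlice {w : ℂ} (hw : 0 < w.re) : MemLp (expSlice w) 2 :=
  (memLp_indicator_iff_restrict measurableSet_Ioi).2 (memLp_exp_neg_mul hw)

theorem integrable_expSlice {w : ℂ} (hw : 0 < w.re) : Integrable (expSlice w) := by
  rw [expSlice, integrable_indicator_iff measurableSet_Ioi]
  exact integrableOn_exp_mul_complex_Ioi (by simpa using hw) 0

theorem fourier_expSlice {w : ℂ} (hw : 0 < w.re) (ξ : ℝ) :
    𝓕 (expSlice w) ξ = 1 / (w + ((ξ * (2 * Real.pi) : ℝ) : ℂ) * Complex.I) := by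
  have h := integral_exp_mul_complex_Ioi (a := -(w + ((ξ * (2 * Real.pi) : ℝ) : ℂ) * Complex.I))
    (by simpa using hw) 0
  rw [Complex.ofReal_zero, mul_zero, Complex.exp_zero, neg_div_neg_eq] at h
  rw [Real.fourier_eq', ← h, ← integral_indicator measurableSet_Ioi]
  congr 1
  ext t
  by_cases ht : t ∈ Ioi (0 : ℝ)
  · simp only [expSlice, indicator_of_mem ht, smul_eq_mul]
    rw [← Complex.exp_add]
    congr 1
    simp only [RCLike.inner_apply, conj_trivial]
    push_cast
    ring
  · simp [expSlice, indicator_of_notMem ht]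

/-- To the right of any vertical line, a function in `H₂(ℂ⁺)` is a Laplace transform. -/
theorem exists_laplace_eq_shift (F : HardyTwo) {x : ℝ} (hx : 0 < x) :
    ∃ g : LTwoPos, eLpNorm g 2 (volume.restrict (Ioi 0)) ≤ hardyENorm F ∧
      ∀ z : ℂ, 0 < z.re → laplace g z = zeroExt F (x + z) := by
  let G : Lp ℂ 2 (volume : Measure ℝ) := (memLp_lineSlice F hx).toLp _
  let u : Lp ℂ 2 (volume : Measure ℝ) := 𝓕⁻ G
  have hu : 𝓕 u = G := FourierTransform.fourier_fourierInv_eq G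
  let g : LTwoPos := ((Lp.memLp u).restrict (Ioi 0)).toLp _
  have hg : g =ᵐ[volume.restrict (Ioi 0)] u := MemLp.coeFn_toLp _
  refine ⟨g, ?_, fun z hz => ?_⟩
  · rw [eLpNorm_congr_ae hg]
    refine (eLpNorm_mono_measure _ Measure.restrict_le_self).trans ?_
    have h : eLpNorm u 2 volume = eLpNorm G 2 volume := by
      have := Lp.norm_fourier_eq u
      rwa [hu, Lp.norm_def, Lp.norm_def, ENNReal.toReal_eq_toReal_iff' (Lp.eLpNorm_ne_top _)
        (Lp.eLpNorm_ne_top _), eq_comm] at this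
    rw [h, eLpNorm_congr_ae (MemLp.coeFn_toLp _), eLpNorm_lineSlice F.2.1 hx]
    exact lineNorm_le F hx
  · have hcz : 0 < (conj z).re := by simpa using hz
    -- The exponential lives on `(0,∞)`, so pairing with it sees only the positive half of `u`.
    -- Whether `u` vanishes on the negative half-line never has to be decided: Plancherel turns this
    -- pairing into the Cauchy integral of `F`.
    have e1 : laplace g z = inner ℂ ((memLp_expSlice hcz).toLp _) u := by
      rw [laplace_eq_of_ae hg, laplace, ← integral_indicator measurableSet_Ioi, L2.inner_def]
      apply integral_congr_ae
      filter_upwards [(memLp_expSlice hcz).coeFn_toLp] with t ht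
      rw [ht, RCLike.inner_apply]
      by_cases h : t ∈ Ioi (0 : ℝ)
      · simp [expSlice, indicator_of_mem h, ← Complex.exp_conj]
      · simp [expSlice, indicator_of_notMem h]
    rw [e1, ← Lp.inner_fourier_eq, hu, L2.inner_def]
    have e2 : ∀ᵐ ξ : ℝ, inner ℂ
        ((𝓕 ((memLp_expSlice hcz).toLp _) : Lp ℂ 2 (volume : Measure ℝ)) ξ) (G ξ) =
        (fun y : ℝ => zeroExt F (x + y * Complex.I) / (z - y * Complex.I))
          (ξ * (2 * Real.pi)) := by
      filter_upwards [coeFn_fourier_toLp (integrable_expSlice hcz) (memLp_expSlice hcz),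
        (memLp_lineSlice F hx).coeFn_toLp] with ξ h1 h2
      rw [h1, h2, fourier_expSlice hcz, RCLike.inner_apply]
      simp only [lineSlice, one_mul, map_inv₀, map_add, map_mul, Complex.conj_conj,
        Complex.conj_ofReal, Complex.conj_I, div_eq_mul_inv, sub_eq_add_neg, mul_neg]
    refine (integral_congr_ae e2).trans ((Measure.integral_comp_mul_right (fun y : ℝ =>
      zeroExt F (x + y * Complex.I) / (z - y * Complex.I)) (2 * Real.pi)).trans ?_)
    rw [cauchy_integral_line F hx hz,
      abs_of_pos (by positivity), Complex.real_smul]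
    have : (Real.pi : ℂ) ≠ 0 := by exact_mod_cast Real.pi_ne_zero
    push_cast
    field_simp

theorem laplace_mul_exp (f : ℝ → ℂ) (w z : ℂ) :
    laplace (fun t => f t * Complex.exp (-w * t)) z = laplace f (z + w) := by
  simp only [laplace, mul_assoc, ← Complex.exp_add]
  congr 1
  ext t
  ring_nf

theorem laplace_injective {f g : LTwoPos} (h : ∀ z : ℂ, 0 < z.re → laplace f z = laplace g z) :
    f = g :=
  laplaceIsometry.injective (HardyTwo.ext fun z => h z z.2)

/-- The Paley-Wiener theorem. -/
theorem laplaceIsometry_surjective : Function.Surjective laplaceIsometry := by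
  intro F
  choose! g hgn hg using fun (x : ℝ) (hx : 0 < x) => exists_laplace_eq_shift F hx
  -- Both sides have Laplace transform `F(1 + z)`, so the functions attached to different lines
  -- differ by exponential damping alone. The undamped function is then `g 1 t * e^t`.
  have hrel : ∀ x : ℝ, 0 < x → x < 1 → (fun t : ℝ => g x t * Complex.exp (-((1 - x : ℝ) : ℂ) * t))
      =ᵐ[volume.restrict (Ioi 0)] g 1 := by
    intro x hx hx1
    have hm : MemLp (fun t : ℝ => g x t * Complex.exp (-((1 - x : ℝ) : ℂ) * t)) 2
        (volume.restrict (Ioi 0)) :=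
      ⟨(Lp.aestronglyMeasurable _).mul (by fun_prop),
        (eLpNorm_mul_exp_le (g x) (sub_pos.2 hx1).le).trans_lt (Lp.eLpNorm_lt_top _)⟩
    have : hm.toLp _ = g 1 := by
      refine laplace_injective fun z hz => ?_
      rw [laplace_eq_of_ae hm.coeFn_toLp, laplace_mul_exp, hg 1 one_pos z hz, hg x hx]
      · congr 1
        push_cast
        ring
      · simp
        linarith
    rw [← this]
    exact hm.coeFn_toLp.symm
  let f : ℝ → ℂ := fun t => g 1 t * Complex.exp t
  have hfm : AEStronglyMeasurable f (volume.restrict (Ioi 0)) :=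
    (Lp.aestronglyMeasurable _).mul (by fun_prop)
  have hfg : ∀ x : ℝ, 0 < x → x < 1 →
      (fun t : ℝ => f t * Complex.exp (-(x : ℂ) * t)) =ᵐ[volume.restrict (Ioi 0)] g x := by
    intro x hx hx1
    filter_upwards [hrel x hx hx1] with t ht
    simp only [f]
    rw [← ht, mul_assoc, mul_assoc, ← Complex.exp_add, ← Complex.exp_add]
    convert mul_one _
    rw [Complex.exp_eq_one_iff]
    exact ⟨0, by push_cast; ring⟩
  let v : ℕ → ℝ := fun n => 1 / ((n : ℝ) + 1)
  have hf2 : MemLp f 2 (volume.restrict (Ioi 0)) := by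
    refine ⟨hfm, lt_of_le_of_lt ?_ F.2.2⟩
    -- Fatou as `x → 0`, each damped function having norm at most that of `F`. The index is shifted
    -- because `v 0 = 1`, whereas `hfg` needs `x < 1`.
    refine (Lp.eLpNorm_lim_le_liminf_eLpNorm
      (f := fun n t => f t * Complex.exp (-(v (n + 1) : ℂ) * t)) ?_ f ?_).trans ?_
    · exact fun n => hfm.mul (by fun_prop)
    · refine Filter.Eventually.of_forall fun t => ?_
      have : Tendsto (fun n => f t * Complex.exp (-(v (n + 1) : ℂ) * t)) atTop
          (𝓝 (f t * Complex.exp (-((0 : ℝ) : ℂ) * t))) :=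
        ((Continuous.tendsto (by fun_prop :
          Continuous fun a : ℝ => f t * Complex.exp (-(a : ℂ) * t)) 0).comp
            (tendsto_one_div_add_atTop_nhds_zero_nat.comp (tendsto_add_atTop_nat 1)))
      simpa using this
    · refine liminf_le_of_frequently_le' (Frequently.of_forall fun n => ?_)
      have h1 : 0 < v (n + 1) := by positivity
      have h2 : v (n + 1) < 1 := by
        simp only [v]
        rw [div_lt_one (by positivity)]
        push_cast
        linarith [n.cast_nonneg (α := ℝ)]
      rw [eLpNorm_congr_ae (hfg _ h1 h2)]
      exact hgn _ h1
  refine ⟨hf2.toLp f, HardyTwo.ext fun z => ?_⟩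
  rw [laplaceIsometry_apply, laplace_eq_of_ae hf2.coeFn_toLp]
  have hz : 0 < (z : ℂ).re := z.2
  obtain ⟨x, hx, hxm⟩ := exists_between (lt_min hz one_pos)
  have hxz := hxm.trans_le (min_le_left _ _)
  have hx1 := hxm.trans_le (min_le_right _ _)
  have h1 := hg x hx (z - x) (by simpa using hxz)
  rw [← laplace_eq_of_ae (hfg x hx hx1), laplace_mul_exp, sub_add_cancel, add_sub_cancel,
    zeroExt_apply _ hz] at h1
  exact h1

/-- The Laplace transform as an isometric isomorphism of `L₂(ℝ⁺)` onto `H₂(ℂ⁺)`. -/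
def laplaceEquiv : LTwoPos ≃ₗᵢ[ℂ] HardyTwo :=
  LinearIsometryEquiv.ofSurjective laplaceIsometry laplaceIsometry_surjective

theorem laplaceEquiv_apply (f : LTwoPos) (z : CPlus) : laplaceEquiv f z = laplace f z := rfl

instance : CompleteSpace HardyTwo :=
  laplaceEquiv.toIsometryEquiv.completeSpace_iff.1 inferInstance

/-! ### Normal operators obtained by averaging unitaries -/

section Average

variable {H : Type*} [NormedAddCommGroup H] [InnerProductSpace ℂ H]

/-- A pair of commuting, mutually adjoint injective operators differ by a unitary. -/
theorem exists_unitary_of_commute_adjoint [CompleteSpace H] {A B : H →L[ℂ] H}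
    (hadj : ∀ f g, inner ℂ (A f) g = inner ℂ f (B g)) (hcomm : ∀ f, A (B f) = B (A f))
    (hB : Function.Injective B) : ∃ W : H ≃ₗᵢ[ℂ] H, ∀ f, A (W f) = B f := by
  have hadj' : ∀ f g, inner ℂ (B f) g = inner ℂ f (A g) := fun f g => by
    rw [← inner_conj_symm, ← hadj, inner_conj_symm]
  -- Normality: `⟨Bf, Bf⟩ = ⟨f, ABf⟩ = ⟨f, BAf⟩ = ⟨Af, Af⟩`. Hence `Af ↦ Bf` is a well-defined
  -- isometry between the ranges, and both ranges are dense because the adjoint of each operator is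
  -- injective.
  have hnorm : ∀ f, ‖B f‖ = ‖A f‖ := fun f => by
    have h : inner ℂ (B f) (B f) = inner ℂ (A f) (A f) := by
      rw [hadj', hadj, hcomm]
    rw [inner_self_eq_norm_sq_to_K, inner_self_eq_norm_sq_to_K] at h
    have h2 : ‖B f‖ ^ 2 = ‖A f‖ ^ 2 := by exact_mod_cast h
    exact (pow_left_inj₀ (norm_nonneg _) (norm_nonneg _) two_ne_zero).1 h2
  have hA : Function.Injective A := by
    rw [injective_iff_map_eq_zero] at hB ⊢
    intro f hf
    apply hB
    rw [← norm_eq_zero, hnorm, hf, norm_zero]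
  have dense_of : ∀ {S T : H →L[ℂ] H}, (∀ f g, inner ℂ (S f) g = inner ℂ f (T g)) →
      Function.Injective T → DenseRange S := by
    intro S T hST hT
    have h : (LinearMap.range (S : H →ₗ[ℂ] H)).topologicalClosure = ⊤ := by
      rw [Submodule.topologicalClosure_eq_top_iff, Submodule.eq_bot_iff]
      intro g hg
      rw [Submodule.mem_orthogonal] at hg
      apply (injective_iff_map_eq_zero T).1 hT
      rw [← inner_self_eq_zero (𝕜 := ℂ), ← hST]
      exact hg _ ⟨_, rfl⟩
    have h2 := (Submodule.dense_iff_topologicalClosure_eq_top).2 h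
    exact h2
  have hdA : DenseRange (A : H →ₗ[ℂ] H) := dense_of hadj hB
  have hdB : DenseRange (B : H →ₗ[ℂ] H) := dense_of hadj' hA
  refine ⟨(LinearEquiv.refl ℂ H).extendOfIsometry (A : H →ₗ[ℂ] H) (B : H →ₗ[ℂ] H) hdA hdB hnorm,
    fun f => ?_⟩
  -- On the dense range of `A`, `W(Ag) = Bg` gives `A(W(Ag)) = ABg = B(Ag)`.
  refine hdA.induction_on (p := fun f => A (_ : H) = B f) f ?_ fun g => ?_
  · exact isClosed_eq (A.continuous.comp (LinearIsometryEquiv.continuous _)) B.continuous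
  · exact (congrArg A (LinearEquiv.extendOfIsometry_eq (LinearEquiv.refl ℂ H) (A : H →ₗ[ℂ] H)
      (B : H →ₗ[ℂ] H) hdA hdB hnorm g)).trans (hcomm g)

theorem integrable_smul_orbit {U : ℝ → H ≃ₗᵢ[ℂ] H} {φ : ℝ → ℝ} {μ : Measure ℝ}
    (hU : ∀ f, Continuous fun t => U t f) (hφ : Integrable φ μ) (f : H) :
    Integrable (fun t => (φ t : ℂ) • U t f) μ := by
  refine (hφ.norm.mul_const ‖f‖).mono' ?_ (Eventually.of_forall fun t => ?_)
  · exact (Complex.continuous_ofReal.comp_aestronglyMeasurable hφ.1).smul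
      (hU f).aestronglyMeasurable
  · rw [norm_smul, LinearIsometryEquiv.norm_map, Complex.norm_real]

/-- The operator `∫ φ(t) U(t) dμ(t)` for a strongly continuous family of unitaries `U`. -/
def averageOp (μ : Measure ℝ) (φ : ℝ → ℝ) (U : ℝ → H ≃ₗᵢ[ℂ] H)
    (hU : ∀ f, Continuous fun t => U t f) (hφ : Integrable φ μ) : H →L[ℂ] H :=
  LinearMap.mkContinuous
    { toFun := fun f => ∫ t, (φ t : ℂ) • U t f ∂μ
      map_add' := fun f g => by
        simp only [map_add, smul_add]
        exact integral_add (integrable_smul_orbit hU hφ f) (integrable_smul_orbit hU hφ g)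
      map_smul' := fun c f => by
        simp only [map_smul, smul_comm _ c, RingHom.id_apply]
        exact integral_smul c _ }
    (∫ t, ‖φ t‖ ∂μ) fun f => by
      refine (norm_integral_le_integral_norm _).trans_eq ?_
      rw [← integral_mul_const]
      simp only [norm_smul, LinearIsometryEquiv.norm_map, Complex.norm_real]

variable {μ : Measure ℝ} {φ : ℝ → ℝ} {U V : ℝ → H ≃ₗᵢ[ℂ] H}
  {hU : ∀ f, Continuous fun t => U t f} {hV : ∀ f, Continuous fun t => V t f}
  {hφ : Integrable φ μ}

theorem averageOp_apply (f : H) : averageOp μ φ U hU hφ f = ∫ t, (φ t : ℂ) • U t f ∂μ := rfl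

theorem inner_averageOp [CompleteSpace H] (f g : H) :
    inner ℂ g (averageOp μ φ U hU hφ f) = ∫ t, (φ t : ℂ) * inner ℂ g (U t f) ∂μ := by
  rw [averageOp_apply, ← integral_inner (integrable_smul_orbit hU hφ f)]
  simp only [inner_smul_right]

theorem inner_averageOp_left [CompleteSpace H] (h : ∀ t f g, inner ℂ (U t f) g = inner ℂ f (V t g)) (f g : H) :
    inner ℂ (averageOp μ φ U hU hφ f) g = inner ℂ f (averageOp μ φ V hV hφ g) := by
  rw [inner_averageOp, ← inner_conj_symm, inner_averageOp, ← integral_conj]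
  congr 1
  ext t
  rw [map_mul, Complex.conj_ofReal, inner_conj_symm, h]

/-- Each `V t` passes through the integral of the `U s`, and the resulting bounded operator then
passes through the integral of the `V t`. No double integral is exchanged. -/
theorem averageOp_comm [CompleteSpace H] (h : ∀ s t f, U s (V t f) = V t (U s f)) (f : H) :
    averageOp μ φ U hU hφ (averageOp μ φ V hV hφ f) =
      averageOp μ φ V hV hφ (averageOp μ φ U hU hφ f) := by
  have h1 : ∀ t g, averageOp μ φ U hU hφ (V t g) = V t (averageOp μ φ U hU hφ g) := by
    intro t g
    rw [averageOp_apply, averageOp_apply]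
    refine Eq.trans ?_
      ((V t).toContinuousLinearEquiv.toContinuousLinearMap.integral_comp_comm
        (integrable_smul_orbit hU hφ g))
    congr 1
    ext s
    rw [h]
    exact ((V t).map_smul _ _).symm
  rw [averageOp_apply (U := V), ← ContinuousLinearMap.integral_comp_comm _
    (integrable_smul_orbit hV hφ f), averageOp_apply (U := V)]
  simp only [map_smul, h1]

end Average

/-! ### The unitary dilation group on both sides of the Laplace transform -/

/-- The factor `e^{-t/2}` cancels the Jacobian factor `e^{t/2}` in the `L₂` norm on lines. The
inequality suffices: applied to the inverse dilation as well, it gives the isometry. -/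
theorem hardyENorm_dilateFun_le (t : ℝ) (F : CPlus → ℂ) :
    hardyENorm (dilateFun t F) ≤ hardyENorm F := by
  refine iSup₂_le fun x hx => ?_
  have h : ‖(Real.exp (-t / 2) : ℂ)‖ₑ *
      ENNReal.ofReal |(Real.exp (-t))⁻¹| ^ (1 / (2 : ℝ≥0∞)).toReal = 1 := by
    rw [← Real.exp_neg, neg_neg, Real.abs_exp, ← ofReal_norm, Complex.norm_real,
      Real.norm_of_nonneg (Real.exp_pos _).le,
      ENNReal.ofReal_rpow_of_pos (Real.exp_pos _), ← ENNReal.ofReal_mul (Real.exp_pos _).le,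
      ← Real.exp_mul, ← Real.exp_add]
    simp
    ring
  rw [lineNorm_dilateFun, ← mul_assoc, h, one_mul]
  exact lineNorm_le F (mul_pos (Real.exp_pos _) hx)

theorem hardyDilation_apply (t : ℝ) (F : HardyTwo) (z : CPlus) :
    hardyDilation t F z = (Real.exp (-t / 2) : ℂ) * F (dilatePoint t z) := rfl

theorem hardyDilation_hardyDilation (s t : ℝ) (F : HardyTwo) :
    hardyDilation s (hardyDilation t F) = hardyDilation (s + t) F := by
  apply HardyTwo.ext
  intro z
  simp only [hardyDilation_apply]
  rw [← mul_assoc, ← Complex.ofReal_mul, ← Real.exp_add]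
  congr 2
  · ring_nf
  · refine congrArg (F : CPlus → ℂ) (Subtype.ext ?_)
    simp only [dilatePoint]
    rw [← mul_assoc, ← Complex.ofReal_mul, ← Real.exp_add]
    ring_nf

theorem hardyDilation_zero (F : HardyTwo) : hardyDilation 0 F = F := by
  apply HardyTwo.ext
  intro z
  rw [hardyDilation_apply]
  have : dilatePoint 0 z = z := Subtype.ext (by simp [dilatePoint])
  rw [this]
  simp

theorem norm_hardyDilation (t : ℝ) (F : HardyTwo) : ‖hardyDilation t F‖ = ‖F‖ := by
  have h : ∀ t (F : HardyTwo), ‖hardyDilation t F‖ ≤ ‖F‖ := fun t F =>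
    ENNReal.toReal_mono F.2.2.ne (hardyENorm_dilateFun_le t F)
  refine le_antisymm (h t F) ?_
  have h2 := h (-t) (hardyDilation t F)
  rwa [hardyDilation_hardyDilation, neg_add_cancel, hardyDilation_zero] at h2

/-- `T₂(t)` as a unitary operator. -/
def hardyDilationEquiv (t : ℝ) : HardyTwo ≃ₗᵢ[ℂ] HardyTwo where
  toLinearEquiv := LinearEquiv.ofLinearMap (hardyDilation t) (hardyDilation (-t))
    (LinearMap.ext fun F => by simp [hardyDilation_hardyDilation, hardyDilation_zero])
    (LinearMap.ext fun F => by simp [hardyDilation_hardyDilation, hardyDilation_zero])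
  norm_map' := norm_hardyDilation t

/-- The unitary dilation group `f ↦ e^{t/2} f(e^t ·)` of `L₂(ℝ⁺)`, transported from `H₂(ℂ⁺)`. -/
def dilation (t : ℝ) : LTwoPos ≃ₗᵢ[ℂ] LTwoPos :=
  (laplaceEquiv.trans (hardyDilationEquiv t)).trans laplaceEquiv.symm

theorem laplaceEquiv_dilation (t : ℝ) (f : LTwoPos) :
    laplaceEquiv (dilation t f) = hardyDilation t (laplaceEquiv f) :=
  laplaceEquiv.apply_symm_apply _

theorem dilation_dilation (s t : ℝ) (f : LTwoPos) :
    dilation s (dilation t f) = dilation (s + t) f := by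
  apply laplaceEquiv.injective
  simp only [laplaceEquiv_dilation, hardyDilation_hardyDilation]

theorem dilation_zero (f : LTwoPos) : dilation 0 f = f := by
  apply laplaceEquiv.injective
  rw [laplaceEquiv_dilation, hardyDilation_zero]

theorem inner_dilation (t : ℝ) (f g : LTwoPos) :
    inner ℂ (dilation t f) g = inner ℂ f (dilation (-t) g) := by
  rw [← LinearIsometryEquiv.inner_map_map (dilation (-t)), dilation_dilation, neg_add_cancel,
    dilation_zero]

theorem laplace_expVec (w : CPlus) (z : CPlus) :
    laplaceEquiv (expVec w) z = 1 / ((z : ℂ) + conj (w : ℂ)) := by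
  have hre : (-((z : ℂ) + conj (w : ℂ))).re < 0 := by
    have h1 := z.2
    have h2 := w.2
    simp
    linarith
  have h := integral_exp_mul_complex_Ioi hre 0
  rw [Complex.ofReal_zero, mul_zero, Complex.exp_zero, neg_div_neg_eq] at h
  rw [laplaceEquiv_apply, laplace_eq_of_ae (coeFn_expVec w), laplace, ← h]
  congr 1
  ext t
  rw [← Complex.exp_add]
  ring_nf

theorem inner_expVec_expVec (z w : CPlus) :
    inner ℂ (expVec z) (expVec w) = 1 / ((z : ℂ) + conj (w : ℂ)) :=
  (inner_expVec z _).trans (laplace_expVec w z)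

/-- Visible after the Laplace transform: scaling `z` in `1/(z + w̄)` is, up to a factor, inverse
scaling of `w`. -/
theorem dilation_expVec (t : ℝ) (w : CPlus) :
    dilation t (expVec w) = (Real.exp (t / 2) : ℂ) • expVec (dilatePoint (-t) w) := by
  apply laplaceEquiv.injective
  apply HardyTwo.ext
  intro z
  rw [laplaceEquiv_dilation, map_smul, HardyTwo.coe_smul, hardyDilation_apply, Pi.smul_apply,
    laplace_expVec, laplace_expVec, smul_eq_mul]
  simp only [dilatePoint, map_mul, Complex.conj_ofReal, neg_neg]
  have h1 : (Real.exp (-t) : ℂ) * z + conj (w : ℂ) =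
      (Real.exp (-t) : ℂ) * (z + Real.exp t * conj (w : ℂ)) := by
    rw [mul_add, ← mul_assoc, ← Complex.ofReal_mul, ← Real.exp_add]
    simp
  have h2 : (Real.exp (-t / 2) : ℂ) = Real.exp (t / 2) * Real.exp (-t) := by
    rw [← Complex.ofReal_mul, ← Real.exp_add]
    ring_nf
  have h3 : (Real.exp (-t) : ℂ) ≠ 0 := by exact_mod_cast (Real.exp_pos _).ne'
  rw [h1, h2, one_div, mul_inv, one_div, mul_assoc, mul_inv_cancel_left₀ h3]

theorem add_conj_ne_zero (z w : CPlus) : (z : ℂ) + conj (w : ℂ) ≠ 0 := fun h => by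
  have h1 := z.2
  have h2 := w.2
  have := congrArg Complex.re h
  simp at this
  linarith

/-- The squared distance of two exponentials expands into four explicit continuous inner products
`1/(z + w̄)`. -/
theorem continuous_expVec : Continuous expVec := by
  rw [continuous_iff_continuousAt]
  intro w
  have hsq : ∀ z : CPlus, ‖expVec z - expVec w‖ ^ 2 =
      (1 / ((z : ℂ) + conj (z : ℂ)) - 1 / ((z : ℂ) + conj (w : ℂ)) -
        (1 / ((w : ℂ) + conj (z : ℂ)) - 1 / ((w : ℂ) + conj (w : ℂ)))).re := by
    intro z
    rw [← inner_self_eq_norm_sq (𝕜 := ℂ), inner_sub_left, inner_sub_right, inner_sub_right]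
    simp only [inner_expVec_expVec]
    rfl
  have hc : Continuous fun z : CPlus =>
      (1 / ((z : ℂ) + conj (z : ℂ)) - 1 / ((z : ℂ) + conj (w : ℂ)) -
        (1 / ((w : ℂ) + conj (z : ℂ)) - 1 / ((w : ℂ) + conj (w : ℂ)))).re := by
    have hj : Continuous fun z : CPlus => conj (z : ℂ) :=
      Complex.continuous_conj.comp continuous_subtype_val
    refine Complex.continuous_re.comp ?_
    refine ((continuous_const.div (by fun_prop) fun z => add_conj_ne_zero z z).sub
      (continuous_const.div (by fun_prop) fun z => add_conj_ne_zero z w)).sub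
      ((continuous_const.div (by fun_prop) fun z => add_conj_ne_zero w z).sub continuous_const)
  have h0 : Tendsto (fun z => ‖expVec z - expVec w‖ ^ 2) (𝓝 w) (𝓝 0) := by
    have h := hc.tendsto w
    simp only [← hsq] at h
    simpa using h
  rw [ContinuousAt, tendsto_iff_norm_sub_tendsto_zero]
  have h1 := (Real.continuous_sqrt.tendsto 0).comp h0
  simpa [Function.comp_def, Real.sqrt_sq (norm_nonneg _)] using h1

theorem eq_zero_of_inner_expVec {f : LTwoPos} (h : ∀ z, inner ℂ (expVec z) f = 0) : f = 0 := by
  apply laplaceIsometry.injective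
  rw [map_zero]
  exact HardyTwo.ext fun z => (inner_expVec z f).symm.trans (h z)

theorem dense_span_expVec :
    (Submodule.span ℂ (range expVec)).topologicalClosure = ⊤ := by
  rw [Submodule.topologicalClosure_eq_top_iff, Submodule.eq_bot_iff]
  intro f hf
  rw [Submodule.mem_orthogonal] at hf
  exact eq_zero_of_inner_expVec fun z => hf _ (Submodule.subset_span ⟨z, rfl⟩)

/-- On exponentials a dilation only moves the parameter, so strong continuity is clear on their
dense span. Since all dilations are isometries, approximation of `f` is uniform in `t`. -/
theorem continuous_dilation (f : LTwoPos) : Continuous fun t => dilation t f := by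
  have hspan : ∀ g ∈ Submodule.span ℂ (range expVec), Continuous fun t => dilation t g := by
    intro g hg
    induction hg using Submodule.span_induction with
    | mem x hx =>
      obtain ⟨w, rfl⟩ := hx
      simp only [dilation_expVec]
      have hd : Continuous fun t : ℝ => dilatePoint (-t) w :=
        Continuous.subtype_mk (by fun_prop) _
      have he : Continuous fun t : ℝ => (Real.exp (t / 2) : ℂ) := by fun_prop
      exact he.smul (continuous_expVec.comp hd)
    | zero => simpa using continuous_const
    | add x y _ _ hx hy => simp only [map_add]; exact hx.add hy
    | smul c x _ hx => simp only [map_smul]; exact hx.const_smul c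
  refine continuous_of_uniform_approx_of_continuous fun u hu => ?_
  obtain ⟨ε, hε, hεu⟩ := Metric.mem_uniformity_dist.1 hu
  have hf : f ∈ (Submodule.span ℂ (range expVec)).topologicalClosure := by
    rw [dense_span_expVec]; trivial
  obtain ⟨g, hg, hgd⟩ := Metric.mem_closure_iff.1 hf ε hε
  exact ⟨fun t => dilation t g, hspan g hg, fun t => hεu (by
    rwa [LinearIsometryEquiv.dist_map])⟩

theorem memLp_dilate (t : ℝ) (f : LTwoPos) :
    MemLp (fun s => (Real.exp (t / 2) : ℂ) * f (Real.exp t * s)) 2 (volume.restrict (Ioi 0)) := by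
  have hm : Measurable (f : ℝ → ℂ) := (Lp.stronglyMeasurable f).measurable
  have hf := (memLp_two_iff_integrable_sq_norm (Lp.aestronglyMeasurable f)).1 (Lp.memLp f)
  have hc : MemLp (fun s => f (Real.exp t * s)) 2 (volume.restrict (Ioi 0)) := by
    have hc' : AEStronglyMeasurable (fun s => f (Real.exp t * s)) (volume.restrict (Ioi 0)) :=
      (hm.comp (measurable_const_mul _)).aestronglyMeasurable
    rw [memLp_two_iff_integrable_sq_norm hc']
    have h := integrableOn_Ioi_comp_mul_left_iff (fun u => ‖f u‖ ^ 2) 0 (Real.exp_pos t)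
    rw [mul_zero] at h
    exact h.2 hf
  exact hc.const_mul _

/-- Defining the group by transport makes unitarity and the group law immediate; its pointwise
formula is recovered here by comparing Laplace transforms. -/
theorem coeFn_dilation (t : ℝ) (f : LTwoPos) : dilation t f =ᵐ[volume.restrict (Ioi 0)]
    fun s => (Real.exp (t / 2) : ℂ) * f (Real.exp t * s) := by
  have h : (memLp_dilate t f).toLp _ = dilation t f := by
    apply laplaceEquiv.injective
    apply HardyTwo.ext
    intro z
    rw [laplaceEquiv_dilation, hardyDilation_apply, laplaceEquiv_apply, laplaceEquiv_apply,
      laplace_eq_of_ae (memLp_dilate t f).coeFn_toLp, laplace, laplace]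
    have h1 := integral_comp_mul_left_Ioi
      (fun u => f u * Complex.exp (-(dilatePoint t z : ℂ) * u)) 0 (Real.exp_pos t)
    rw [mul_zero] at h1
    have h2 : ∀ s : ℝ, (Real.exp (t / 2) : ℂ) * f (Real.exp t * s) * Complex.exp (-(z : ℂ) * s) =
        (Real.exp (t / 2) : ℂ) * (f (Real.exp t * s) *
          Complex.exp (-(dilatePoint t z : ℂ) * (Real.exp t * s : ℝ))) := by
      intro s
      rw [mul_assoc]
      congr 3
      simp only [dilatePoint]
      have : (Real.exp (-t) : ℂ) * Real.exp t = 1 := by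
        rw [← Complex.ofReal_mul, ← Real.exp_add]; simp
      push_cast at this ⊢
      linear_combination (z : ℂ) * s * this
    simp only [h2]
    rw [integral_const_mul, h1, Complex.real_smul, ← mul_assoc, ← Complex.ofReal_mul,
      ← Real.exp_neg, ← Real.exp_add]
    ring_nf
  rw [← h]
  exact (memLp_dilate t f).coeFn_toLp

theorem integral_norm_sq_dilate (t : ℝ) (f : LTwoPos) :
    ∫ s in Ioi (0 : ℝ), ‖(Real.exp (t / 2) : ℂ) * f (Real.exp t * s)‖ ^ 2 =
      ∫ s in Ioi (0 : ℝ), ‖f s‖ ^ 2 := by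
  have h1 := integral_comp_mul_left_Ioi (fun u => ‖f u‖ ^ 2) 0 (Real.exp_pos t)
  rw [mul_zero] at h1
  simp only [norm_mul, mul_pow, Complex.norm_real, Real.norm_eq_abs, Real.abs_exp]
  rw [integral_const_mul, h1, smul_eq_mul, ← mul_assoc, ← Real.exp_nat_mul, ← Real.exp_neg,
    ← Real.exp_add, show ((2 : ℕ) : ℝ) * (t / 2) + -t = 0 by push_cast; ring, Real.exp_zero, one_mul]

/-! ### The weight and the averaged dilations -/

theorem image_exp_neg_Ioi : (fun t : ℝ => Real.exp (-t)) '' Ioi 0 = Ioo 0 1 := by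
  ext x
  constructor
  · rintro ⟨t, ht, rfl⟩
    exact ⟨Real.exp_pos _, Real.exp_lt_one_iff.2 (by simpa using ht)⟩
  · rintro ⟨h0, h1⟩
    refine ⟨-Real.log x, ?_, by simp [Real.exp_log h0]⟩
    simpa using Real.log_neg h0 h1

theorem hasDerivAt_exp_neg (t : ℝ) :
    HasDerivAt (fun t : ℝ => Real.exp (-t)) (-Real.exp (-t)) t := by
  simpa using (hasDerivAt_id t).neg.exp

theorem injOn_exp_neg (s : Set ℝ) : InjOn (fun t : ℝ => Real.exp (-t)) s :=
  fun _ _ _ _ h => by simpa using h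

theorem integrableOn_Ioo_iff_exp_neg {E : Type*} [NormedAddCommGroup E] [NormedSpace ℝ E]
    (g : ℝ → E) : IntegrableOn g (Ioo 0 1) ↔
      IntegrableOn (fun t => Real.exp (-t) • g (Real.exp (-t))) (Ioi 0) := by
  rw [← image_exp_neg_Ioi, integrableOn_image_iff_integrableOn_abs_deriv_smul measurableSet_Ioi
    (fun t _ => (hasDerivAt_exp_neg t).hasDerivWithinAt) (injOn_exp_neg _)]
  simp only [abs_neg, Real.abs_exp]

theorem integral_Ioo_eq_exp_neg {E : Type*} [NormedAddCommGroup E] [NormedSpace ℝ E]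
    (g : ℝ → E) : ∫ x in Ioo 0 1, g x =
      ∫ t in Ioi 0, Real.exp (-t) • g (Real.exp (-t)) := by
  rw [← image_exp_neg_Ioi, integral_image_eq_integral_abs_deriv_smul measurableSet_Ioi
    (fun t _ => (hasDerivAt_exp_neg t).hasDerivWithinAt) (injOn_exp_neg _)]
  simp only [abs_neg, Real.abs_exp]

/-- The integrand of `B(1/2, α)`. Under `x = e^{-t}` it becomes the weight `subordinator α` up to
the factor `α`; it also majorises the kernel. -/
theorem integrableOn_beta {α : ℝ} (hα : 0 < α) :
    IntegrableOn (fun x : ℝ => (1 - x) ^ (α - 1) * x ^ (-(1 / 2) : ℝ)) (Ioo 0 1) := by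
  have h := Complex.betaIntegral_convergent (u := ((1 / 2 : ℝ) : ℂ)) (v := α)
    (by rw [Complex.ofReal_re]; norm_num) (by simpa using hα)
  rw [intervalIntegrable_iff_integrableOn_Ioo_of_le zero_le_one] at h
  refine IntegrableOn.congr_fun h.re (fun x hx => ?_) measurableSet_Ioo
  have h1 : (0 : ℝ) ≤ 1 - x := by linarith [hx.2]
  have e1 : (x : ℂ) ^ (((1 / 2 : ℝ) : ℂ) - 1) = ((x ^ (-(1 / 2) : ℝ) : ℝ) : ℂ) := by
    rw [Complex.ofReal_cpow hx.1.le]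
    congr 1
    push_cast
    norm_num
  have e2 : (1 - (x : ℂ)) ^ ((α : ℂ) - 1) = (((1 - x) ^ (α - 1) : ℝ) : ℂ) := by
    rw [Complex.ofReal_cpow h1]
    push_cast
    rfl
  simp only [e1, e2]
  rw [← Complex.ofReal_mul]
  exact mul_comm _ _

theorem integrableOn_subordinator {α : ℝ} (hα : 0 < α) : IntegrableOn (subordinator α) (Ioi 0) := by
  have h := ((integrableOn_Ioo_iff_exp_neg _).1 (integrableOn_beta hα)).const_mul α
  refine IntegrableOn.congr_fun h (fun t _ => ?_) measurableSet_Ioi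
  simp only [smul_eq_mul, subordinator]
  rw [← Real.exp_mul, mul_left_comm (Real.exp (-t)), ← Real.exp_add, ← mul_assoc]
  ring_nf

/-- `∫₀^∞ φ(t) e^{t/2} f(e^t ·) dt`. -/
def cesaroOp (α : ℝ) (hα : 0 < α) : LTwoPos →L[ℂ] LTwoPos :=
  averageOp (volume.restrict (Ioi 0)) (subordinator α) dilation continuous_dilation
    (integrableOn_subordinator hα)

/-- `∫₀^∞ φ(t) e^{-t/2} f(e^{-t} ·) dt`, the adjoint of `cesaroOp`. -/
def cesaroAdj (α : ℝ) (hα : 0 < α) : LTwoPos →L[ℂ] LTwoPos :=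
  averageOp (volume.restrict (Ioi 0)) (subordinator α) (fun t => dilation (-t))
    (fun f => (continuous_dilation f).comp continuous_neg) (integrableOn_subordinator hα)

theorem inner_cesaroOp {α : ℝ} (hα : 0 < α) (f g : LTwoPos) :
    inner ℂ (cesaroOp α hα f) g = inner ℂ f (cesaroAdj α hα g) :=
  inner_averageOp_left inner_dilation f g

theorem cesaroOp_comm {α : ℝ} (hα : 0 < α) (f : LTwoPos) :
    cesaroOp α hα (cesaroAdj α hα f) = cesaroAdj α hα (cesaroOp α hα f) :=
  averageOp_comm (fun s t f => by simp only [dilation_dilation, add_comm]) f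

/-- On a set of finite measure, `v ≤ 1 + v²` and invariance of the `L₂` norm bound the `L₁` norm of
the dilated function uniformly in `t`. The weight then supplies integrability in `t`, which licenses
Fubini. -/
theorem integrable_prod_dilate {α : ℝ} (hα : 0 < α) (f : LTwoPos) {S : Set ℝ}
    (hS : (volume.restrict (Ioi (0 : ℝ))) S < ∞) :
    Integrable (fun p : ℝ × ℝ => (subordinator α p.1 : ℂ) *
        ((Real.exp (p.1 / 2) : ℂ) * f (Real.exp p.1 * p.2)))
      ((volume.restrict (Ioi 0)).prod ((volume.restrict (Ioi 0)).restrict S)) := by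
  have : IsFiniteMeasure ((volume.restrict (Ioi (0 : ℝ))).restrict S) :=
    isFiniteMeasure_restrict.2 hS.ne
  set ν := (volume.restrict (Ioi (0 : ℝ))).restrict S
  have hm : Measurable (f : ℝ → ℂ) := (Lp.stronglyMeasurable f).measurable
  have hφm : Measurable (subordinator α) := by
    unfold subordinator
    fun_prop
  have hmeas : Measurable fun p : ℝ × ℝ => (subordinator α p.1 : ℂ) *
        ((Real.exp (p.1 / 2) : ℂ) * f (Real.exp p.1 * p.2)) :=
    (Complex.measurable_ofReal.comp (hφm.comp measurable_fst)).mul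
      ((by fun_prop : Measurable fun p : ℝ × ℝ => (Real.exp (p.1 / 2) : ℂ)).mul
        (hm.comp (by fun_prop)))
  have hL : ∀ t, MemLp (fun s => (Real.exp (t / 2) : ℂ) * f (Real.exp t * s)) 2 ν := fun t =>
    (memLp_dilate t f).restrict S
  rw [integrable_prod_iff hmeas.aestronglyMeasurable]
  refine ⟨Eventually.of_forall fun t =>
    ((hL t).integrable (by norm_num)).const_mul (subordinator α t : ℂ), ?_⟩
  refine ((integrableOn_subordinator hα).norm.mul_const
    (ν.real univ + ∫ s in Ioi (0 : ℝ), ‖f s‖ ^ 2)).mono'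
    hmeas.aestronglyMeasurable.norm.integral_prod_right' (Eventually.of_forall fun t => ?_)
  rw [Real.norm_of_nonneg (integral_nonneg fun s => norm_nonneg _)]
  simp only [norm_mul (subordinator α t : ℂ), Complex.norm_real]
  rw [integral_const_mul]
  gcongr
  have hsq := (memLp_two_iff_integrable_sq_norm (memLp_dilate t f).1).1 (memLp_dilate t f)
  calc ∫ s, ‖(Real.exp (t / 2) : ℂ) * f (Real.exp t * s)‖ ∂ν
      ≤ ∫ s, (1 + ‖(Real.exp (t / 2) : ℂ) * f (Real.exp t * s)‖ ^ 2) ∂ν := by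
        refine integral_mono ((hL t).integrable (by norm_num)).norm
          ((integrable_const 1).add hsq.restrict) fun s => ?_
        simp only
        nlinarith [sq_nonneg (‖(Real.exp (t / 2) : ℂ) * f (Real.exp t * s)‖ - 1)]
    _ = ν.real univ + ∫ s, ‖(Real.exp (t / 2) : ℂ) * f (Real.exp t * s)‖ ^ 2 ∂ν := by
        rw [integral_add (integrable_const 1) hsq.restrict, integral_const, smul_eq_mul, mul_one]
    _ ≤ _ := by
        rw [← integral_norm_sq_dilate t f]
        exact add_le_add le_rfl
          (setIntegral_le_integral hsq (Eventually.of_forall fun s => by positivity))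

/-! ### The pointwise Cesàro integral as an average of dilations -/

theorem image_mul_exp_Ioi {s : ℝ} (hs : 0 < s) : (fun t : ℝ => Real.exp t * s) '' Ioi 0 = Ioi s := by
  ext u
  constructor
  · rintro ⟨t, ht, rfl⟩
    exact lt_mul_of_one_lt_left hs (Real.one_lt_exp_iff.2 ht)
  · intro hu
    have hu' : s < u := hu
    refine ⟨Real.log (u / s), Real.log_pos ((one_lt_div hs).2 hu'), ?_⟩
    simp only
    rw [Real.exp_log (div_pos (hs.trans hu') hs), div_mul_cancel₀ _ hs.ne']

theorem hasDerivAt_mul_exp (s t : ℝ) :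
    HasDerivAt (fun t : ℝ => Real.exp t * s) (Real.exp t * s) t :=
  (Real.hasDerivAt_exp t).mul_const s

theorem injOn_mul_exp {s : ℝ} (hs : 0 < s) (S : Set ℝ) : InjOn (fun t : ℝ => Real.exp t * s) S :=
  fun _ _ _ _ h => Real.exp_injective (mul_right_cancel₀ hs.ne' h)

/-- Under `u = e^t s`, `u - s = u(1 - e^{-t})`, so the powers of `u`, including the one from the
Jacobian, cancel. -/
theorem abs_smul_cesaroIntegrand (α : ℝ) (f : ℝ → ℂ) {s t : ℝ} (hs : 0 < s) (ht : 0 < t) :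
    (α : ℂ) * (|Real.exp t * s| • cesaroIntegrand α f s (Real.exp t * s)) =
      (subordinator α t : ℂ) * ((Real.exp (t / 2) : ℂ) * f (Real.exp t * s)) := by
  have hE : 0 < Real.exp t := Real.exp_pos t
  have h1 : 0 < 1 - Real.exp (-t) := sub_pos.2 (Real.exp_lt_one_iff.2 (by linarith))
  have e1 : Real.exp t * s - s = Real.exp t * s * (1 - Real.exp (-t)) := by
    rw [mul_sub, mul_one, mul_right_comm, ← Real.exp_add]
    simp
  have hEs : 0 < Real.exp t * s := mul_pos hE hs
  have key : Real.exp t * s * ((Real.exp t * s - s) ^ (α - 1) / (Real.exp t * s) ^ α) =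
      (1 - Real.exp (-t)) ^ (α - 1) := by
    rw [e1, Real.mul_rpow hEs.le h1.le, Real.rpow_sub_one hEs.ne']
    have : (Real.exp t * s) ^ α ≠ 0 := (Real.rpow_pos_of_pos hEs α).ne'
    field_simp
  have e2 : Real.exp (-t / 2) * Real.exp (t / 2) = 1 := by
    rw [← Real.exp_add]; ring_nf; exact Real.exp_zero
  rw [abs_of_pos hEs, cesaroIntegrand, Complex.real_smul, ← mul_assoc, ← mul_assoc, ← mul_assoc,
    ← Complex.ofReal_mul, ← Complex.ofReal_mul, ← Complex.ofReal_mul, mul_assoc α, key, subordinator,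
    mul_assoc (α * _), e2, mul_one]

theorem integrableOn_cesaroIntegrand_iff {α : ℝ} (hα : 0 < α) (f : ℝ → ℂ) {s : ℝ} (hs : 0 < s) :
    IntegrableOn (cesaroIntegrand α f s) (Ioi s) ↔ IntegrableOn (fun t => (subordinator α t : ℂ) *
      ((Real.exp (t / 2) : ℂ) * f (Real.exp t * s))) (Ioi 0) := by
  rw [← image_mul_exp_Ioi hs, integrableOn_image_iff_integrableOn_abs_deriv_smul measurableSet_Ioi
    (fun t _ => (hasDerivAt_mul_exp s t).hasDerivWithinAt) (injOn_mul_exp hs _), IntegrableOn,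
    ← integrable_const_mul_iff (c := (α : ℂ)) (IsUnit.mk0 _ (by exact_mod_cast hα.ne'))]
  exact integrableOn_congr_fun (fun t ht => abs_smul_cesaroIntegrand α f hs ht) measurableSet_Ioi

theorem cesaroFun_eq (α : ℝ) (f : ℝ → ℂ) {s : ℝ} (hs : 0 < s) :
    cesaroFun α f s = ∫ t in Ioi 0, (subordinator α t : ℂ) *
      ((Real.exp (t / 2) : ℂ) * f (Real.exp t * s)) := by
  rw [cesaroFun, ← image_mul_exp_Ioi hs, integral_image_eq_integral_abs_deriv_smul measurableSet_Ioi
    (fun t _ => (hasDerivAt_mul_exp s t).hasDerivWithinAt) (injOn_mul_exp hs _),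
    ← integral_const_mul]
  exact setIntegral_congr_fun measurableSet_Ioi
    fun t ht => abs_smul_cesaroIntegrand α f hs ht

theorem ae_integrableOn_cesaroIntegrand {α : ℝ} (hα : 0 < α) (f : LTwoPos) :
    ∀ᵐ s ∂volume.restrict (Ioi (0 : ℝ)), IntegrableOn (cesaroIntegrand α f s) (Ioi s) := by
  -- The Fubini argument requires finite measure, so the half-line is exhausted by the intervals
  -- `(0, n)`.
  have h : ∀ᵐ s ∂volume.restrict (Ioi (0 : ℝ)), ∀ n : ℕ, s ∈ Iio (n : ℝ) →
      IntegrableOn (cesaroIntegrand α f s) (Ioi s) := by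
    rw [ae_all_iff]
    intro n
    rw [← ae_restrict_iff' measurableSet_Iio]
    have hn : (volume.restrict (Ioi (0 : ℝ))) (Iio (n : ℝ)) < ∞ := by
      rw [Measure.restrict_apply measurableSet_Iio, inter_comm, Ioi_inter_Iio]
      exact measure_Ioo_lt_top
    filter_upwards [(integrable_prod_dilate hα f hn).prod_left_ae,
      ae_restrict_of_ae (ae_restrict_mem measurableSet_Ioi)] with s hs hs0
    exact (integrableOn_cesaroIntegrand_iff hα f hs0).2 hs
  filter_upwards [h] with s hs
  obtain ⟨n, hn⟩ := exists_nat_gt s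
  exact hs n hn

/-- The left side is defined pointwise, the right as a Bochner integral of vectors. They agree
because their integrals over every set of finite measure do: Fubini on one side, pairing with an
indicator on the other. -/
theorem cesaroFun_ae_eq {α : ℝ} (hα : 0 < α) (f : LTwoPos) :
    cesaroFun α f =ᵐ[volume.restrict (Ioi (0 : ℝ))] cesaroOp α hα f := by
  have hcongr : ∀ S : Set ℝ, (fun s => ∫ t in Ioi 0, (subordinator α t : ℂ) *
      ((Real.exp (t / 2) : ℂ) * f (Real.exp t * s))) =ᵐ[(volume.restrict (Ioi (0 : ℝ))).restrict S]
      cesaroFun α f := fun S => by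
    filter_upwards [ae_restrict_of_ae (ae_restrict_mem measurableSet_Ioi)] with s hs
    exact (cesaroFun_eq α f hs).symm
  apply ae_eq_of_forall_setIntegral_eq_of_sigmaFinite
  · intro S _ hS
    exact (integrable_prod_dilate hα f hS).integral_prod_right.congr (hcongr S)
  · intro S _ hS
    have : IsFiniteMeasure ((volume.restrict (Ioi (0 : ℝ))).restrict S) :=
      isFiniteMeasure_restrict.2 hS.ne
    exact ((Lp.memLp (cesaroOp α hα f)).restrict S).integrable (by norm_num)
  · intro S hSm hS
    rw [← integral_congr_ae (hcongr S), ← integral_integral_swap (integrable_prod_dilate hα f hS),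
      ← L2.inner_indicatorConstLp_one (𝕜 := ℂ) hSm hS.ne]
    refine Eq.trans ?_ (inner_averageOp _ _).symm
    congr 1
    ext t
    rw [integral_const_mul, L2.inner_indicatorConstLp_one,
      integral_congr_ae (ae_restrict_of_ae (coeFn_dilation t f))]

theorem cesaroConverges {α : ℝ} (hα : 0 < α) (f : LTwoPos) : CesaroConverges α f :=
  ⟨ae_integrableOn_cesaroIntegrand hα f,
    (Lp.memLp (cesaroOp α hα f)).ae_eq (cesaroFun_ae_eq hα f).symm⟩

theorem cesaroStar_domain {α : ℝ} (hα : 0 < α) : (cesaroStar α).domain = ⊤ :=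
  eq_top_iff.2 fun f _ => cesaroConverges hα f

theorem cesaroStar_apply {α : ℝ} (hα : 0 < α) (f : (cesaroStar α).domain) :
    cesaroStar α f = cesaroOp α hα f := by
  apply Lp.ext
  exact (MemLp.coeFn_toLp (cesaroConverges hα f.1).2).trans (cesaroFun_ae_eq hα _)

/-! ### Injectivity of the operators -/

theorem memLp_rpow_mul_exp {α : ℝ} (hα : 0 < α) {x : ℝ} (hx : 0 < x) :
    MemLp (fun s : ℝ => ((s ^ α * Real.exp (-x * s) : ℝ) : ℂ)) 2 (volume.restrict (Ioi 0)) := by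
  have hm : AEStronglyMeasurable (fun s : ℝ => ((s ^ α * Real.exp (-x * s) : ℝ) : ℂ))
      (volume.restrict (Ioi 0)) := Measurable.aestronglyMeasurable (by fun_prop)
  rw [memLp_two_iff_integrable_sq_norm hm]
  have h := integrableOn_rpow_mul_exp_neg_mul_rpow (s := 2 * α) (p := 1) (b := 2 * x)
    (by linarith) one_pos (by positivity)
  refine IntegrableOn.congr_fun h (fun s hs => ?_) measurableSet_Ioi
  simp only [Complex.norm_real, Real.norm_eq_abs, sq_abs, mul_pow, ← Real.exp_nat_mul,
    Real.rpow_one]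
  rw [mul_comm 2 α, Real.rpow_mul (le_of_lt hs), Real.rpow_ofNat]
  push_cast
  ring_nf

/-- Exponentials belong to the range of the Cesàro-Hardy operator. -/
theorem exists_cesaroOp_eq_expVec {α : ℝ} (hα : 0 < α) {x : ℝ} (hx : 0 < x) :
    ∃ h : LTwoPos, ∃ c : ℂ, c ≠ 0 ∧
      cesaroOp α hα h = c • expVec ⟨(x : ℂ), by simpa using hx⟩ := by
  have hJ := Real.integral_rpow_mul_exp_neg_mul_Ioi hα hx
  set J : ℝ := ∫ t : ℝ in Ioi 0, t ^ (α - 1) * Real.exp (-(x * t)) with hJdef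
  have hJpos : 0 < J := by
    rw [hJ]
    exact mul_pos (Real.rpow_pos_of_pos (by positivity) _) (Real.Gamma_pos_of_pos hα)
  -- The preimage is `s^α e^{-xs}`: its power cancels `u^{-α}`, and translating `u = v + s` leaves
  -- `e^{-xs}` times the Gamma integral `J`.
  let h : LTwoPos := (memLp_rpow_mul_exp hα hx).toLp _
  refine ⟨h, ((α * J : ℝ) : ℂ), ?_, ?_⟩
  · exact_mod_cast (mul_pos hα hJpos).ne'
  apply Lp.ext
  refine (cesaroFun_ae_eq hα h).symm.trans ?_
  filter_upwards [Lp.coeFn_smul ((α * J : ℝ) : ℂ) (expVec ⟨(x : ℂ), by simpa using hx⟩),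
    coeFn_expVec ⟨(x : ℂ), by simpa using hx⟩, ae_restrict_mem measurableSet_Ioi] with s h1 h2 hs
  have hs0 : (0 : ℝ) < s := hs
  rw [h1, Pi.smul_apply, h2, smul_eq_mul, cesaroFun, Complex.ofReal_mul, mul_assoc]
  congr 1
  have e1 : ∫ u in Ioi s, cesaroIntegrand α h s u =
      ∫ u in Ioi s, (((u - s) ^ (α - 1) * Real.exp (-x * u) : ℝ) : ℂ) := by
    apply integral_congr_ae
    filter_upwards [ae_restrict_Ioi_of_pos hs0 (memLp_rpow_mul_exp hα hx).coeFn_toLp,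
      ae_restrict_mem measurableSet_Ioi] with u hu hus
    have hu0 : 0 < u := hs0.trans hus
    rw [cesaroIntegrand, hu, ← Complex.ofReal_mul]
    have : u ^ α ≠ 0 := (Real.rpow_pos_of_pos hu0 α).ne'
    congr 1
    field_simp
  have e2 : ∫ u in Ioi s, (u - s) ^ (α - 1) * Real.exp (-x * u) = J * Real.exp (-x * s) := by
    have himg : (fun v : ℝ => v + s) '' Ioi 0 = Ioi s := by simp
    rw [← himg, integral_image_eq_integral_abs_deriv_smul measurableSet_Ioi
      (f := fun v : ℝ => v + s) (f' := fun _ => 1)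
      (fun v _ => ((hasDerivAt_id v).add_const s).hasDerivWithinAt)
      (fun _ _ _ _ hab => add_right_cancel hab), hJdef, ← integral_mul_const]
    congr 1
    ext v
    simp only [abs_one, one_smul, add_sub_cancel_right]
    rw [mul_assoc, ← Real.exp_add]
    ring_nf
  rw [e1, integral_complex_ofReal, e2]
  push_cast
  simp

/-- The Laplace transform is determined by its values on the positive half-line. -/
theorem eq_zero_of_laplace_real {f : LTwoPos} (h : ∀ x : ℝ, 0 < x → laplace f x = 0) : f = 0 := by
  have hd : DifferentiableOn ℂ (laplace f) {z | 0 < z.re} := fun z hz =>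
    (differentiableAt_laplace f hz).differentiableWithinAt
  have ha := hd.analyticOnNhd (isOpen_lt continuous_const Complex.continuous_re)
  have hfreq : ∃ᶠ z in 𝓝[≠] (1 : ℂ), laplace f z = 0 := by
    -- The zeros `1 + 1/(n+1)` accumulate at the interior point `1`.
    have ht : Tendsto (fun n : ℕ => ((1 + 1 / ((n : ℝ) + 1) : ℝ) : ℂ)) atTop (𝓝[≠] (1 : ℂ)) := by
      refine tendsto_nhdsWithin_iff.2 ⟨?_, Eventually.of_forall fun n => ?_⟩
      · have := (Complex.continuous_ofReal.tendsto _).comp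
          (tendsto_one_div_add_atTop_nhds_zero_nat.const_add (1 : ℝ))
        simpa [Function.comp_def] using this
      · have hn : (0 : ℝ) < 1 / ((n : ℝ) + 1) := by positivity
        rw [mem_compl_iff, mem_singleton_iff, ← Complex.ofReal_one, Complex.ofReal_inj]
        linarith
    exact ht.frequently (Frequently.of_forall fun n => h _ (by positivity))
  have hz := ha.eqOn_zero_of_preconnected_of_frequently_eq_zero
    (convex_halfSpace_re_gt 0).isPreconnected (by simp) hfreq
  apply laplaceIsometry.injective
  rw [map_zero]
  exact HardyTwo.ext fun z => hz z.2

/-- If the adjoint kills `f`, then `f` is orthogonal to the range of `cesaroOp`, in particular to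
all real exponentials, so its Laplace transform vanishes on `(0,∞)`. -/
theorem cesaroAdj_injective {α : ℝ} (hα : 0 < α) : Function.Injective (cesaroAdj α hα) := by
  rw [injective_iff_map_eq_zero]
  intro f hf
  refine eq_zero_of_laplace_real fun x hx => ?_
  obtain ⟨h, c, hc, hh⟩ := exists_cesaroOp_eq_expVec hα hx
  have h1 := inner_cesaroOp hα h f
  rw [hf, inner_zero_right, hh, inner_smul_left, inner_expVec, mul_eq_zero] at h1
  exact h1.resolve_left fun h => hc (by simpa using h)

theorem exists_unitary_cesaro {α : ℝ} (hα : 0 < α) :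
    ∃ W : LTwoPos ≃ₗᵢ[ℂ] LTwoPos, ∀ f, cesaroOp α hα (W f) = cesaroAdj α hα f :=
  exists_unitary_of_commute_adjoint (inner_cesaroOp hα) (cesaroOp_comm hα) (cesaroAdj_injective hα)

/-- Normality transfers injectivity from the adjoint: `cesaroOp` is `cesaroAdj` composed with `W⁻¹`.
-/
theorem cesaroOp_injective {α : ℝ} (hα : 0 < α) : Function.Injective (cesaroOp α hα) := by
  obtain ⟨W, hW⟩ := exists_unitary_cesaro hα
  intro f g hfg
  have h := cesaroAdj_injective hα (a₁ := W.symm f) (a₂ := W.symm g) (by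
    rw [← hW, ← hW, W.apply_symm_apply, W.apply_symm_apply, hfg])
  exact W.symm.injective h

theorem ker_cesaroStar {α : ℝ} (hα : 0 < α) : LinearMap.ker (cesaroStar α).toFun = ⊥ := by
  rw [LinearMap.ker_eq_bot']
  intro f hf
  have h : cesaroOp α hα f = 0 := (cesaroStar_apply hα f).symm.trans hf
  exact Subtype.ext ((injective_iff_map_eq_zero _).1 (cesaroOp_injective hα) _ h)

/-! ### The complex operator and the two range spaces -/

theorem smul_hardyDilation_laplaceEquiv (α t : ℝ) (f : LTwoPos) :
    (subordinator α t : ℂ) • hardyDilation (-t) (laplaceEquiv f) =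
      laplaceEquiv.toContinuousLinearEquiv.toContinuousLinearMap
        ((subordinator α t : ℂ) • dilation (-t) f) := by
  rw [map_smul]
  exact congrArg _ (laplaceEquiv_dilation (-t) f).symm

theorem integrable_adj_orbit {α : ℝ} (hα : 0 < α) (f : LTwoPos) :
    IntegrableOn (fun t : ℝ => (subordinator α t : ℂ) • dilation (-t) f) (Ioi 0) :=
  integrable_smul_orbit (U := fun t => dilation (-t))
    (fun f => (continuous_dilation f).comp continuous_neg) (integrableOn_subordinator hα) f

theorem hardyCesaroStar_domain {α : ℝ} (hα : 0 < α) : (hardyCesaroStar α).domain = ⊤ := by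
  refine eq_top_iff.2 fun F _ => ?_
  obtain ⟨f, rfl⟩ := laplaceEquiv.surjective F
  change IntegrableOn (fun t : ℝ =>
    (subordinator α t : ℂ) • hardyDilation (-t) (laplaceEquiv f)) (Ioi 0)
  simp only [smul_hardyDilation_laplaceEquiv]
  exact ContinuousLinearMap.integrable_comp _ (integrable_adj_orbit hα f)

theorem hardyCesaroStar_apply {α : ℝ} (hα : 0 < α) (f : LTwoPos)
    (hf : laplaceEquiv f ∈ (hardyCesaroStar α).domain) :
    hardyCesaroStar α ⟨laplaceEquiv f, hf⟩ = laplaceEquiv (cesaroAdj α hα f) := by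
  change ∫ t in Ioi (0 : ℝ), (subordinator α t : ℂ) • hardyDilation (-t) (laplaceEquiv f) = _
  simp only [smul_hardyDilation_laplaceEquiv]
  exact ContinuousLinearMap.integral_comp_comm _ (integrable_adj_orbit hα f)

theorem ker_hardyCesaroStar {α : ℝ} (hα : 0 < α) :
    LinearMap.ker (hardyCesaroStar α).toFun = ⊥ := by
  rw [LinearMap.ker_eq_bot']
  rintro ⟨F, hF⟩ h
  obtain ⟨f, rfl⟩ := laplaceEquiv.surjective F
  have h1 : laplaceEquiv (cesaroAdj α hα f) = 0 := (hardyCesaroStar_apply hα f hF).symm.trans h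
  have h2 := (injective_iff_map_eq_zero _).1 (cesaroAdj_injective hα) _
    ((injective_iff_map_eq_zero _).1 laplaceEquiv.injective _ h1)
  exact Subtype.ext (by simp [h2])

theorem cesaroOp_mem {α : ℝ} (hα : 0 < α) (f : LTwoPos) : cesaroOp α hα f ∈ LebesgueSobolev α := by
  rw [LebesgueSobolev, LinearPMap.inverse_domain]
  exact ⟨⟨f, by rw [cesaroStar_domain hα]; trivial⟩, cesaroStar_apply hα _⟩

theorem laplaceEquiv_cesaroAdj_mem {α : ℝ} (hα : 0 < α) (f : LTwoPos) :
    laplaceEquiv (cesaroAdj α hα f) ∈ HardySobolev α := by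
  rw [HardySobolev, LinearPMap.inverse_domain]
  exact ⟨⟨laplaceEquiv f, by rw [hardyCesaroStar_domain hα]; trivial⟩, hardyCesaroStar_apply hα f _⟩

/-- The Cesàro-Hardy operator as a linear isomorphism onto its range. -/
def cesaroEquiv (α : ℝ) (hα : 0 < α) : LTwoPos ≃ₗ[ℂ] LebesgueSobolev α :=
  LinearEquiv.ofBijective
    ((cesaroOp α hα : LTwoPos →ₗ[ℂ] LTwoPos).codRestrict _ (cesaroOp_mem hα)) ⟨by
      intro f g h
      exact cesaroOp_injective hα (congrArg Subtype.val h), by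
      rintro ⟨g, hg⟩
      have hg' := hg
      rw [LebesgueSobolev, LinearPMap.inverse_domain] at hg'
      obtain ⟨f, hf⟩ := hg'
      exact ⟨f, Subtype.ext ((cesaroStar_apply hα f).symm.trans hf)⟩⟩

theorem cesaroEquiv_apply {α : ℝ} (hα : 0 < α) (f : LTwoPos) :
    (cesaroEquiv α hα f : LTwoPos) = cesaroOp α hα f := rfl

theorem lebesgueSobolevNorm_cesaroEquiv {α : ℝ} (hα : 0 < α) (f : LTwoPos) :
    lebesgueSobolevNorm α (cesaroEquiv α hα f) = Real.Gamma (α + 1) * ‖f‖ := by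
  have h : (cesaroStar α).inverse (cesaroEquiv α hα f) = f :=
    LinearPMap.inverse_apply_eq (ker_cesaroStar hα)
      (x := ⟨f, by rw [cesaroStar_domain hα]; trivial⟩) (cesaroStar_apply hα _)
  rw [lebesgueSobolevNorm, h]

/-- The complex Cesàro-Hardy operator, precomposed with the Laplace transform, as a linear
isomorphism onto its range. -/
def hardyCesaroEquiv (α : ℝ) (hα : 0 < α) : LTwoPos ≃ₗ[ℂ] HardySobolev α :=
  LinearEquiv.ofBijective
    (((laplaceEquiv : LTwoPos →ₗ[ℂ] HardyTwo) ∘ₗ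
      (cesaroAdj α hα : LTwoPos →ₗ[ℂ] LTwoPos)).codRestrict _ (laplaceEquiv_cesaroAdj_mem hα)) ⟨by
      intro f g h
      exact cesaroAdj_injective hα (laplaceEquiv.injective
        (congrArg (fun F : HardySobolev α => (F : HardyTwo)) h)), by
      rintro ⟨G, hG⟩
      have hG' := hG
      rw [HardySobolev, LinearPMap.inverse_domain] at hG'
      obtain ⟨⟨F, hF⟩, hFG⟩ := hG'
      obtain ⟨f, rfl⟩ := laplaceEquiv.surjective F
      exact ⟨f, Subtype.ext ((hardyCesaroStar_apply hα f hF).symm.trans hFG)⟩⟩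

theorem hardyCesaroEquiv_apply {α : ℝ} (hα : 0 < α) (f : LTwoPos) :
    (hardyCesaroEquiv α hα f : HardyTwo) = laplaceEquiv (cesaroAdj α hα f) := rfl

theorem hardySobolevNorm_hardyCesaroEquiv {α : ℝ} (hα : 0 < α) (f : LTwoPos) :
    hardySobolevNorm α (hardyCesaroEquiv α hα f) = Real.Gamma (α + 1) * ‖f‖ := by
  have h : (hardyCesaroStar α).inverse (hardyCesaroEquiv α hα f) = laplaceEquiv f :=
    LinearPMap.inverse_apply_eq (ker_hardyCesaroStar hα)
      (x := ⟨laplaceEquiv f, by rw [hardyCesaroStar_domain hα]; trivial⟩)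
      (hardyCesaroStar_apply hα f _)
  rw [hardySobolevNorm, h, laplaceEquiv.norm_map]

/-- With `A W = B`, the map `Af ↦ ℒ(B(W⁻¹f))` is just `Af ↦ ℒ(Af)`. Both range norms equal `Γ(α+1)`
times the norm of the preimage, and `W⁻¹` preserves it. -/
theorem exists_laplace_sobolev_equiv {α : ℝ} (hα : 0 < α) :
    ∃ L : LebesgueSobolev α ≃ₗ[ℂ] HardySobolev α,
      (∀ (f : LebesgueSobolev α) (z : CPlus), (L f : HardyTwo) z = laplace (f : LTwoPos) z) ∧
      ∀ f : LebesgueSobolev α, hardySobolevNorm α (L f) = lebesgueSobolevNorm α f := by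
  obtain ⟨W, hW⟩ := exists_unitary_cesaro hα
  refine ⟨((cesaroEquiv α hα).symm.trans W.symm.toLinearEquiv).trans (hardyCesaroEquiv α hα),
    fun g z => ?_, fun g => ?_⟩ <;> obtain ⟨f, rfl⟩ := (cesaroEquiv α hα).surjective g
  · have h : ((((cesaroEquiv α hα).symm.trans W.symm.toLinearEquiv).trans (hardyCesaroEquiv α hα)
        (cesaroEquiv α hα f) : HardySobolev α) : HardyTwo) = laplaceEquiv (cesaroOp α hα f) := by
      simp only [LinearEquiv.trans_apply, LinearEquiv.symm_apply_apply, hardyCesaroEquiv_apply]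
      rw [← hW]
      exact congrArg (fun u => laplaceEquiv (cesaroOp α hα u)) (W.apply_symm_apply f)
    rw [h, laplaceEquiv_apply, cesaroEquiv_apply]
  · simp only [LinearEquiv.trans_apply, LinearEquiv.symm_apply_apply]
    rw [hardySobolevNorm_hardyCesaroEquiv, lebesgueSobolevNorm_cesaroEquiv]
    exact congrArg _ (W.symm.norm_map f)

/-! ### The reproducing kernel -/

/-- Both averages are expanded, and `x = e^{-t}`, `y = e^{-r}` bring the parameters into `(0,1)`.
The constant comes from `Γ(α+1) = αΓ(α)`, used once for each variable. -/
theorem inner_cesaroAdj_expVec {α : ℝ} (hα : 0 < α) (z w : CPlus) :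
    inner ℂ (cesaroAdj α hα (expVec z)) (cesaroAdj α hα (expVec w)) =
      (Real.Gamma (α + 1) : ℂ) ^ 2 *
        ∫ x in (0 : ℝ)..1, ∫ y in (0 : ℝ)..1, kernelIntegrand α z w x y := by
  have hleft : ∀ g, inner ℂ (cesaroAdj α hα (expVec z)) g =
      ∫ t in Ioi (0 : ℝ), (subordinator α t : ℂ) * inner ℂ (dilation (-t) (expVec z)) g := by
    intro g
    rw [← inner_conj_symm]
    refine (congrArg _ (inner_averageOp (expVec z) g)).trans ?_
    rw [← integral_conj]
    simp only [map_mul, Complex.conj_ofReal, inner_conj_symm]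
  rw [hleft]
  simp only [intervalIntegral.integral_of_le zero_le_one, integral_Ioc_eq_integral_Ioo]
  rw [integral_Ioo_eq_exp_neg, ← integral_const_mul]
  congr 1
  ext t
  rw [integral_Ioo_eq_exp_neg]
  have hright := inner_averageOp (μ := volume.restrict (Ioi 0)) (φ := subordinator α)
    (U := fun t => dilation (-t)) (hU := fun f => (continuous_dilation f).comp continuous_neg)
    (hφ := integrableOn_subordinator hα) (expVec w) (dilation (-t) (expVec z))
  refine (congrArg _ hright).trans ?_
  rw [← integral_const_mul, ← integral_smul, ← integral_const_mul]
  congr 1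
  ext r
  rw [dilation_expVec, dilation_expVec, inner_smul_left, inner_smul_right, inner_expVec_expVec,
    neg_neg, neg_neg, Complex.conj_ofReal, kernelIntegrand]
  simp only [dilatePoint, map_mul, Complex.conj_ofReal, Complex.real_smul, subordinator]
  have hΓ : Real.Gamma α ≠ 0 := (Real.Gamma_pos_of_pos hα).ne'
  have hexp : ∀ t : ℝ, Real.exp (-t) = Real.exp (-t / 2) * Real.exp (-t / 2) := fun t => by
    rw [← Real.exp_add]; ring_nf
  rw [Real.Gamma_add_one hα.ne']
  generalize (1 : ℂ) / ((Real.exp (-t) : ℂ) * z + (Real.exp (-r) : ℂ) * conj (w : ℂ)) = q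
  generalize (1 - Real.exp (-t)) ^ (α - 1) = A
  generalize (1 - Real.exp (-r)) ^ (α - 1) = B
  rw [hexp t, hexp r]
  generalize Real.exp (-t / 2) = a
  generalize Real.exp (-r / 2) = b
  have hΓ' : (Real.Gamma α : ℂ) ≠ 0 := by exact_mod_cast hΓ
  push_cast
  field_simp

/-- The real part of the denominator is at least `min (Re z) (Re w)` times `x + y`, and `x + y ≥ √x
√y`. The point is that the resulting majorant factors, so the double integral is controlled by a
product of two Beta integrals. -/
theorem norm_kernel_le {x y : ℝ} (hx : 0 < x) (hy : 0 < y) (z w : CPlus) :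
    ‖1 / (x * (z : ℂ) + y * conj (w : ℂ))‖ ≤
      (min (z : ℂ).re (w : ℂ).re)⁻¹ * (x ^ (-(1 / 2) : ℝ) * y ^ (-(1 / 2) : ℝ)) := by
  have hm : 0 < min (z : ℂ).re (w : ℂ).re := lt_min z.2 w.2
  have hre : min (z : ℂ).re (w : ℂ).re * (√x * √y) ≤ ‖x * (z : ℂ) + y * conj (w : ℂ)‖ := by
    refine le_trans ?_ (Complex.re_le_norm _)
    have e : (x * (z : ℂ) + y * conj (w : ℂ)).re = x * (z : ℂ).re + y * (w : ℂ).re := by simp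
    rw [e]
    have h1 : √x * √y ≤ x + y := by
      nlinarith [sq_nonneg (√x - √y), Real.sq_sqrt hx.le, Real.sq_sqrt hy.le,
        Real.sqrt_nonneg x, Real.sqrt_nonneg y]
    calc _ ≤ min (z : ℂ).re (w : ℂ).re * (x + y) := by gcongr
      _ ≤ _ := by
        have h2 := mul_le_mul_of_nonneg_left (min_le_left (z : ℂ).re (w : ℂ).re) hx.le
        have h3 := mul_le_mul_of_nonneg_left (min_le_right (z : ℂ).re (w : ℂ).re) hy.le
        linarith
  have hpos : 0 < √x * √y := mul_pos (Real.sqrt_pos.2 hx) (Real.sqrt_pos.2 hy)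
  rw [norm_div, norm_one, one_div, Real.rpow_neg hx.le, Real.rpow_neg hy.le, ← Real.sqrt_eq_rpow,
    ← Real.sqrt_eq_rpow, ← mul_inv, ← mul_inv]
  exact inv_anti₀ (mul_pos hm hpos) hre

theorem integrableOn_kernelIntegrand {α : ℝ} (hα : 0 < α) (z w : CPlus) :
    IntegrableOn (fun p : ℝ × ℝ => kernelIntegrand α z w p.1 p.2) (Ioo 0 1 ×ˢ Ioo 0 1) := by
  have h := (Integrable.mul_prod (integrableOn_beta hα) (integrableOn_beta hα)).const_mul
    ((Real.Gamma α ^ 2)⁻¹ * (min (z : ℂ).re (w : ℂ).re)⁻¹)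
  rw [Measure.prod_restrict, ← Measure.volume_eq_prod] at h
  refine h.mono' ?_ ?_
  · unfold kernelIntegrand
    exact Measurable.aestronglyMeasurable (by fun_prop)
  · filter_upwards [ae_restrict_mem (measurableSet_Ioo.prod measurableSet_Ioo)] with p hp
    have hx : 0 ≤ (1 - p.1) ^ (α - 1) := Real.rpow_nonneg (by linarith [hp.1.2]) _
    have hy : 0 ≤ (1 - p.2) ^ (α - 1) := Real.rpow_nonneg (by linarith [hp.2.2]) _
    have hΓ : 0 < Real.Gamma α := Real.Gamma_pos_of_pos hα
    rw [kernelIntegrand, norm_mul, Complex.norm_real, Real.norm_of_nonneg (by positivity)]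
    refine (mul_le_mul_of_nonneg_left (norm_kernel_le hp.1.1 hp.2.1 z w) (by positivity)).trans_eq ?_
    field_simp

/-- The reproducing kernel Hilbert space structure on `L₂(ℝ⁺)` given by
`f ↦ Γ(α+1)⁻¹ ℒ(C_α f)`. -/
@[reducible]
def cesaroRKHS (α : ℝ) (hα : 0 < α) : RKHS ℂ LTwoPos CPlus ℂ where
  coeCLM := ContinuousLinearMap.pi fun z =>
    ((Real.Gamma (α + 1) : ℂ)⁻¹) • ((innerSL ℂ (expVec z)).comp (cesaroAdj α hα))
  coeCLM_injective := by
    intro f g h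
    apply cesaroAdj_injective hα
    rw [← sub_eq_zero]
    refine eq_zero_of_inner_expVec fun z => ?_
    have hz := congrFun h z
    have hΓ : (Real.Gamma (α + 1) : ℂ)⁻¹ ≠ 0 :=
      inv_ne_zero (by exact_mod_cast (Real.Gamma_pos_of_pos (by linarith)).ne')
    have hz' : inner ℂ (expVec z) (cesaroAdj α hα f) = inner ℂ (expVec z) (cesaroAdj α hα g) :=
      mul_left_cancel₀ hΓ hz
    rw [inner_sub_right, hz', sub_self]

theorem isRKHSWithKernel_hardySobolev {α : ℝ} (hα : 0 < α) :
    IsRKHSWithKernel (fun (F : HardySobolev α) (z : CPlus) => (F : HardyTwo) z)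
      (hardySobolevNorm α)
      (fun z w => ∫ x in (0 : ℝ)..1, ∫ y in (0 : ℝ)..1, kernelIntegrand α z w x y) := by
  have hG : 0 < Real.Gamma (α + 1) := Real.Gamma_pos_of_pos (by linarith)
  have hΓ : (Real.Gamma (α + 1) : ℂ) ≠ 0 := by exact_mod_cast hG.ne'
  let rk := cesaroRKHS α hα
  have hcoe : ∀ (f : LTwoPos) (z : CPlus), RKHS.instFunLike.coe f z =
      (Real.Gamma (α + 1) : ℂ)⁻¹ * inner ℂ (expVec z) (cesaroAdj α hα f) := fun f z => rfl
  -- The model is `L₂(ℝ⁺)` itself. Multiplying the preimage by `Γ(α+1)` absorbs the constant of the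
  -- norm, and the factor `Γ(α+1)⁻¹` built into the evaluations of `cesaroRKHS` compensates.
  refine ⟨LTwoPos, inferInstance, inferInstance, inferInstance, rk,
    (hardyCesaroEquiv α hα).symm.trans (LinearEquiv.smulOfNeZero ℂ LTwoPos _ hΓ), ?_, ?_, ?_⟩
  · intro F z
    obtain ⟨f, rfl⟩ := (hardyCesaroEquiv α hα).surjective F
    rw [LinearEquiv.trans_apply, LinearEquiv.symm_apply_apply]
    refine (hcoe _ z).trans ?_
    rw [LinearEquiv.smulOfNeZero_apply, map_smul, inner_smul_right, inv_mul_cancel_left₀ hΓ]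
    exact inner_expVec z _
  · intro F
    obtain ⟨f, rfl⟩ := (hardyCesaroEquiv α hα).surjective F
    rw [LinearEquiv.trans_apply, LinearEquiv.symm_apply_apply, LinearEquiv.smulOfNeZero_apply,
      norm_smul, Complex.norm_real, Real.norm_of_nonneg hG.le,
      hardySobolevNorm_hardyCesaroEquiv hα]
  · intro z w
    have hk : RKHS.kerFun LTwoPos w (1 : ℂ) =
        (Real.Gamma (α + 1) : ℂ)⁻¹ • cesaroOp α hα (expVec w) := by
      refine ext_inner_right ℂ fun f => ?_
      rw [RKHS.kerFun_inner, inner_smul_left, inner_cesaroOp, map_inv₀, Complex.conj_ofReal]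
      refine Eq.trans ?_ (hcoe f w)
      simp
    rw [← RKHS.kerFun_apply, hk]
    refine (hcoe _ z).trans ?_
    -- Commutation puts the adjoint next to `expVec w`, and adjunction moves the other operator onto
    -- `expVec z`. Both entries then involve `cesaroAdj`, whose action on exponentials contracts the
    -- parameter by `e^{-t} ∈ (0,1)`.
    rw [map_smul, inner_smul_right, ← cesaroOp_comm hα, ← inner_conj_symm, inner_cesaroOp,
      inner_conj_symm, inner_cesaroAdj_expVec hα]
    field_simp

end

theorem theorem6p2 (α : ℝ) (hα : 0 < α) :
    -- the operators `C*_α` and `𝔠*_α` are everywhere defined and injective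
    ((cesaroStar α).domain = ⊤ ∧ LinearMap.ker (cesaroStar α).toFun = ⊥ ∧
      (hardyCesaroStar α).domain = ⊤ ∧ LinearMap.ker (hardyCesaroStar α).toFun = ⊥) ∧
    -- (i) reproducing kernel
    ((∀ z w : CPlus, IntegrableOn (fun p : ℝ × ℝ => kernelIntegrand α z w p.1 p.2)
        (Ioo 0 1 ×ˢ Ioo 0 1)) ∧
      IsRKHSWithKernel (fun (F : HardySobolev α) (z : CPlus) => (F : HardyTwo) z)
        (hardySobolevNorm α)
        (fun z w => ∫ x in (0 : ℝ)..1, ∫ y in (0 : ℝ)..1, kernelIntegrand α z w x y)) ∧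
    -- (ii) the Laplace transform is an isometric isomorphism
    (∃ L : LebesgueSobolev α ≃ₗ[ℂ] HardySobolev α,
      (∀ (f : LebesgueSobolev α) (z : CPlus), (L f : HardyTwo) z = laplace (f : LTwoPos) z) ∧
      ∀ f : LebesgueSobolev α, hardySobolevNorm α (L f) = lebesgueSobolevNorm α f) :=
  ⟨⟨cesaroStar_domain hα, ker_cesaroStar hα, hardyCesaroStar_domain hα, ker_hardyCesaroStar hα⟩,
    ⟨integrableOn_kernelIntegrand hα, isRKHSWithKernel_hardySobolev hα⟩,
    exists_laplace_sobolev_equiv hα⟩
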